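/- **Setting.** Let $\mathcal S\subset\mathbb R^{m}$ and $\mathcal A\subset\mathbb R^{k}$ be nonempty compact sets, $\mathcal Z=\mathcal S\times\mathcal A\subset\mathbb R^d$ with $d=m+k$. Consider a discounted MDP with discount factor $\gamma\in(0,1)$, transition distribution $P(\cdot\mid s,a)$ on $\mathcal S$, and measurable reward $r:\mathcal Z\to[0,1]$ such that $a\mapsto r(s,a)$ is continuous for every $s$. For a (possibly random) policy $\pi$ let $V^\pi(s)=\mathbb E\big[\sum_{t\ge0}\gamma^t r(s_t,a_t)\mid s_0=s\big]$, where $a_t\sim\pi(\cdot\mid s_t)$ and $s_{t+1}\sim P(\cdot\mid s_t,a_t)$, and let $V^*(s)=\sup_\pi V^\pi(s)$. Let $K$ be a continuous positive semidefinite kernel on $\mathcal Z$ with $K(z,z)\le1$, let $\mathcal H_K$ be its RKHS, and let $\lambda>0$. For points $U=(z_1,\dots,z_J)$ (repetitions allowed) put $K_U=[K(z_i,z_j)]_{i,j}$, $k_U(z)=[K(z,z_j)]_j$, $$\Sigma_U^2(z)=K(z,z)-k_U(z)^\top(K_U+\lambda^2I)^{-1}k_U(z),\qquad \Gamma_{K,\lambda}(J)=\sup_{U\in\mathcal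 Z^J}\tfrac12\log\det\big(I_J+\lambda^{-2}K_U\big).$$ **Assumption 1 (discretization), with constant $c_0>0$.** For all integers $n\ge1$ and reals $B\ge1$ there is a finite set $D\subset\mathcal Z$ with $|D|\le c_0B^dn^d$ such that, for a choice $[z]\in D$ of a Euclidean-closest point to each $z\in\mathcal Z$, $f(z)-f([z])\le 1/n$ for all $z$ and all $f\in\mathcal H_K$ with $\|f\|_{\mathcal H_K}\le B$. **Assumption 2 (RKHS norm bound).** With respect to a finite measure $\nu$ on $\mathcal S$ (for instance Lebesgue measure, or counting measure if $\mathcal S$ is finite), $P(\cdot\mid z)$ has a density $p(\cdot\mid z)\ge0$ for every $z\in\mathcal Z$, and $\|p(s'\mid\cdot)\|_{\mathcal H_K}\le1$ for every $s'\in\mathcal S$. Write $c=\nu(\mathcal S)$ for the volume of $\mathcal S$. **Algorithm (KQLearn) with $J\ge1$ points and $L\ge1$ rounds.** Choose successively $z_j\in\arg\max_{z\in\mathcal Z}\Sigma^2_{(z_1,\dots,z_{j-1})}(z)$ for $j=1,\dots,J$ (ties broken arbitrarily), and put $U=(z_1,\dots,z_J)$. For $Y\in\mathbb R^J$ let $\widehat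 Q_Y(z)=r(z)+\gamma\,k_U(z)^\top(K_U+\lambda^2I_J)^{-1}Y$. Set $Y^{(0)}=0$. In round $\ell=1,\dots,L$ draw independent samples $s'_{\ell,j}\sim P(\cdot\mid z_j)$, $j=1,\dots,J$, independent of the earlier rounds, and let $Y^{(\ell)}_j$ be the projection of $\max_{a\in\mathcal A}\widehat Q_{Y^{(\ell-1)}}(s'_{\ell,j},a)$ onto $[0,\frac1{1-\gamma}]$. The output is a policy $\pi$ that selects in every state $s$ an action (almost surely) in $\arg\max_{a\in\mathcal A}\widehat Q^{(L)}(s,a)$, where $\widehat Q^{(L)}=\widehat Q_{Y^{(L)}}$. **Theorem.** For every $c_0>0$ there is a constant $C>0$, depending only on $c_0$, such that in the setting above, under Assumptions 1 and 2, for every $\delta\in(0,1)$, with probability at least $1-\delta$ over the $JL$ samples, every such output policy $\pi$ satisfies $$\|V^\pi-V^*\|_\infty\le 2\beta(\delta)\,\frac{\gamma}{(1-\gamma)^2}\sqrt{\frac{2\,\Gamma_{K,\lambda}(J)}{\log(1+1/\lambda^2)\,J}}+\frac{2\gamma^{L-1}}{(1-\gamma)^2},$$ where $$\beta(\delta)=C\left(\frac{c}{1-\gamma}+\frac{1}{2\lambda(1-\gamma)}\sqrt{d\,\log\frac{J}{(1-\gamma)\delta}}\right).$$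 -/

import Mathlib

open MeasureTheory ProbabilityTheory

noncomputable section

namespace KQ

/-! ### Discounted Markov decision processes -/

/-- A discounted Markov decision process with measurable reward in `[0,1]` and discount factor in
`(0,1)`. `P (s, a)` is the distribution of the next state. -/
structure MDP (S A : Type*) [MeasurableSpace S] [MeasurableSpace A] where
  P : Kernel (S × A) S
  r : S × A → ℝ
  γ : ℝ
  markov : IsMarkovKernel P
  measurable_r : Measurable r
  r_nonneg : ∀ z, 0 ≤ r z
  r_le_one : ∀ z, r z ≤ 1
  γ_pos : 0 < γ
  γ_lt_one : γ < 1

attribute [instance] MDP.markov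

/-- A (possibly random) policy: a probability distribution on actions for every state. -/
abbrev Policy (S A : Type*) [MeasurableSpace S] [MeasurableSpace A] :=
  {π : Kernel S A // IsMarkovKernel π}

instance {S A : Type*} [MeasurableSpace S] [MeasurableSpace A] (π : Policy S A) :
    IsMarkovKernel π.1 := π.2

namespace MDP

variable {S A : Type*} [MeasurableSpace S] [MeasurableSpace A]

/-- One step of the state-action chain: from `(s, a)` draw `s' ∼ P(· | s, a)`, then
`a' ∼ π(· | s')`. -/
def step (M : MDP S A) (π : Policy S A) : Kernel (S × A) (S × A) :=
  M.P ⊗ₖ Kernel.prodMkLeft (S × A) π.1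

instance (M : MDP S A) (π : Policy S A) : IsMarkovKernel (M.step π) := by
  unfold step; infer_instance

/-- The next state-action pair given the history up to time `n`: only the last pair matters. -/
def historyStep (M : MDP S A) (π : Policy S A) (n : ℕ) :
    Kernel ((i : Finset.Iic n) → S × A) (S × A) :=
  (M.step π).comap (fun h => h ⟨n, Finset.mem_Iic.2 le_rfl⟩) (measurable_pi_apply _)

instance (M : MDP S A) (π : Policy S A) (n : ℕ) : IsMarkovKernel (M.historyStep π n) := by
  unfold historyStep; infer_instance

/-- The law of the trajectory `(s₀, a₀), (s₁, a₁), …` under the policy `π` with `s₀ = s`. -/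
def trajLaw (M : MDP S A) (π : Policy S A) (s : S) : Measure (ℕ → S × A) :=
  Kernel.trajMeasure (X := fun _ => S × A) ((Measure.dirac s) ⊗ₘ π.1) (M.historyStep π)

/-- The value function `V^π(s) = 𝔼[∑ γ^t r(s_t, a_t) | s₀ = s]`. -/
def value (M : MDP S A) (π : Policy S A) (s : S) : ℝ :=
  ∫ ω, ∑' t : ℕ, M.γ ^ t * M.r (ω t) ∂(M.trajLaw π s)

/-- The optimal value function `V^*(s)`, the supremum of `V^π(s)` over all policies. -/
def optValue (M : MDP S A) (s : S) : ℝ := ⨆ π : Policy S A, M.value π s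

end MDP

/-! ### Kernel ridge regression -/

section Ridge

variable {Z : Type*}

/-- The kernel matrix of a finite sequence of points. -/
def gram (K : Z → Z → ℝ) {J : ℕ} (z : Fin J → Z) : Matrix (Fin J) (Fin J) ℝ :=
  Matrix.of fun i j => K (z i) (z j)

/-- The vector of kernel values between `x` and a finite sequence of points. -/
def kvec (K : Z → Z → ℝ) {J : ℕ} (z : Fin J → Z) (x : Z) : Fin J → ℝ := fun j => K x (z j)

/-- Kernel ridge regressor `k(x)ᵀ (K + λ² I)⁻¹ Y`. -/
def krr (K : Z → Z → ℝ) (lam : ℝ) {J : ℕ} (z : Fin J → Z) (Y : Fin J → ℝ) (x : Z) : ℝ :=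
  kvec K z x ⬝ᵥ Matrix.mulVec (gram K z + lam ^ 2 • (1 : Matrix (Fin J) (Fin J) ℝ))⁻¹ Y

/-- Squared uncertainty `Σ²(x) = K(x,x) - k(x)ᵀ (K + λ² I)⁻¹ k(x)`. -/
def uncertaintySq (K : Z → Z → ℝ) (lam : ℝ) {J : ℕ} (z : Fin J → Z) (x : Z) : ℝ :=
  K x x - krr K lam z (kvec K z x) x

/-- `z₁, …, z_J` is a maximum uncertainty design: each point maximizes over all of `Z` the
uncertainty given the points before it (ties are broken arbitrarily). -/
def IsMaxUncertaintyDesign (K : Z → Z → ℝ) (lam : ℝ) {J : ℕ} (z : Fin J → Z) : Prop :=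
  ∀ (j : Fin J) (x : Z),
    uncertaintySq K lam (fun i : Fin j => z (Fin.castLE j.isLt.le i)) x ≤
      uncertaintySq K lam (fun i : Fin j => z (Fin.castLE j.isLt.le i)) (z j)

/-- Maximal information gain of `J` points. -/
def infoGain (K : Z → Z → ℝ) (lam : ℝ) (J : ℕ) : ℝ :=
  ⨆ z : Fin J → Z,
    1 / 2 * Real.log ((1 : Matrix (Fin J) (Fin J) ℝ) + (1 / lam ^ 2) • gram K z).det

end Ridge

/-! ### Assumptions on the kernel -/

/-- `H` is the reproducing kernel Hilbert space of the real-valued kernel `K`. -/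
def IsRKHSOf {Z : Type*} (H : Type*) [NormedAddCommGroup H] [InnerProductSpace ℝ H]
    [CompleteSpace H] [RKHS ℝ H Z ℝ] (K : Z → Z → ℝ) : Prop :=
  ∀ x y, RKHS.kernel H x y 1 = K x y

/-- Squared Euclidean distance of state-action pairs, seen as points of `ℝ^{m + k}`. -/
def sqDist {m k : ℕ} {S : Set (EuclideanSpace ℝ (Fin m))} {A : Set (EuclideanSpace ℝ (Fin k))}
    (z z' : S × A) : ℝ :=
  dist z.1 z'.1 ^ 2 + dist z.2 z'.2 ^ 2

/-- Discretization assumption with constant `cD`: for all `n ≥ 1` and all `B ≥ 1` there is a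
finite set `D` of at most `cD (B n)^d` state-action pairs, `d = m + k`, such that `f z` exceeds
`f [z]` by at most `1 / n` whenever `‖f‖ ≤ B`, where `[z]` is a closest point of `D` to `z`. -/
def HasDiscretization {m k : ℕ} {S : Set (EuclideanSpace ℝ (Fin m))}
    {A : Set (EuclideanSpace ℝ (Fin k))} (H : Type*) [NormedAddCommGroup H]
    [InnerProductSpace ℝ H] [RKHS ℝ H (S × A) ℝ] (cD : ℝ) : Prop :=
  ∀ (n : ℕ) (B : ℝ), 1 ≤ n → 1 ≤ B →
    ∃ (D : Finset (S × A)) (near : S × A → S × A),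
      (D.card : ℝ) ≤ cD * B ^ (m + k) * (n : ℝ) ^ (m + k) ∧
      (∀ z, near z ∈ D ∧ ∀ z' ∈ D, sqDist (near z) z ≤ sqDist z' z) ∧
      ∀ f : H, ‖f‖ ≤ B → ∀ z, f z - f (near z) ≤ 1 / n

/-- The transition distribution has a density `p(s' | s, a)` with respect to `ν`, and for every
`s'` the function `p(s' | ·)` belongs to `H` with norm at most `1`. -/
def HasBoundedDensity {S A : Type*} [MeasurableSpace S] [MeasurableSpace A] (H : Type*)
    [NormedAddCommGroup H] [InnerProductSpace ℝ H] [RKHS ℝ H (S × A) ℝ]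
    (ν : Measure S) (P : Kernel (S × A) S) : Prop :=
  ∃ p : S → S × A → ℝ,
    (∀ s' z, 0 ≤ p s' z) ∧
    (∀ z, Measurable fun s' => p s' z) ∧
    (∀ z, P z = ν.withDensity fun s' => ENNReal.ofReal (p s' z)) ∧
    ∀ s', ∃ f : H, (∀ z, f z = p s' z) ∧ ‖f‖ ≤ 1

/-! ### The algorithm -/

section Algorithm

variable {S A : Type*} [MeasurableSpace S] [MeasurableSpace A]

/-- The proxy Q-function `r(x) + γ k(x)ᵀ (K + λ² I)⁻¹ Y` built from an observation vector. -/
def proxyQ (M : MDP S A) (K : S × A → S × A → ℝ) (lam : ℝ) {J : ℕ} (z : Fin J → S × A)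
    (Y : Fin J → ℝ) (x : S × A) : ℝ :=
  M.r x + M.γ * krr K lam z Y x

/-- The observation vectors `Y^{(ℓ)}`, where `ω ℓ j` is the transition sampled at `z j` in the
round number `ℓ` (rounds are counted from `0` here):
`Y^{(0)} = 0` and each new observation is the projection on `[0, 1 / (1 - γ)]` of the maximum over
the actions of the current proxy Q-function at the sampled state. -/
def observations (M : MDP S A) (K : S × A → S × A → ℝ) (lam : ℝ) {J L : ℕ} (z : Fin J → S × A)
    (ω : Fin L → Fin J → S) : (l : ℕ) → l ≤ L → Fin J → ℝ
  | 0, _ => 0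
  | l + 1, h => fun j =>
      max 0 (min (1 / (1 - M.γ))
        (⨆ a : A, proxyQ M K lam z (observations M K lam z ω l (Nat.le_of_succ_le h))
          (ω ⟨l, h⟩ j, a)))

/-- The output `Q̂^{(L)}` of the algorithm after `L` rounds. -/
def outputQ (M : MDP S A) (K : S × A → S × A → ℝ) (lam : ℝ) {J L : ℕ} (z : Fin J → S × A)
    (ω : Fin L → Fin J → S) : S × A → ℝ :=
  proxyQ M K lam z (observations M K lam z ω L le_rfl)

/-- The law of the `N = L J` samples of the generative model: independent, `ω ℓ j ∼ P(· | z j)`. -/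
def sampleLaw (M : MDP S A) (L : ℕ) {J : ℕ} (z : Fin J → S × A) :
    Measure (Fin L → Fin J → S) :=
  Measure.pi fun _ : Fin L => Measure.pi fun j : Fin J => M.P (z j)

/-- In every state the policy selects (almost surely) a maximizer of `Q`. -/
def IsGreedy (π : Policy S A) (Q : S × A → ℝ) : Prop :=
  ∀ s, ∀ᵐ a ∂(π.1 s), ∀ a', Q (s, a') ≤ Q (s, a)

end Algorithm

/-- The order of the confidence width multiplier `β(δ)`, where `c` is the volume of the state
space: `c / (1 - γ) + (2 λ (1 - γ))⁻¹ √(d log (J / ((1 - γ) δ)))`. -/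
def widthOrder (c γ lam : ℝ) (d J : ℕ) (δ : ℝ) : ℝ :=
  c / (1 - γ) + 1 / (2 * lam * (1 - γ)) * √(d * Real.log (J / ((1 - γ) * δ)))

end KQ

end

/-!
Fix a design with uncertainty at most `u²` everywhere. In feature space the regression replaces
`φ x` by a combination `∑ w_j φ (z_j)` at distance at most `u`, with `λ² ‖w‖² ≤ u²`. Since the
transition density has norm at most one, the conditional mean of the sampled value is a linear
functional of the feature, so every round has bias at most `c u / (1 - γ)`. The noise of a round is
`⟨w, ε⟩` with `ε` independent, centered and bounded by `1 / (1 - γ)` given the earlier rounds, so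
Hoeffding's inequality controls it by `u / (λ (1 - γ))` on a net of feature space and the Lipschitz
bound `√J / (λ (1 - γ))` controls it off the net. Greedy design gives
`J log (1 + u² / λ²) ≤ 2 Γ`, hence `u² ≤ 2 Γ / (log (1 + 1 / λ²) J)`.

Two points keep logarithms of `L` and of `λ` out of the width. In the union bound over the rounds
the noise level of round `l` may grow like `1 + (1 - γ) (L - l)`, because the rounds after it
discount the error by `γ ^ (L - l)`; the sum of the failure probabilities is then a geometric
series. The net has resolution `r / J` with `r² = (u² + λ²) / (1 + λ²)`: its extra cost
`u² log (1 / r)` is still of order `Γ / (log (1 + 1 / λ²) J)`.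
-/

namespace KQ

/-! ### Kernel ridge regression in a feature space -/

section RidgeRegression

open Matrix

variable {Z E : Type*} [NormedAddCommGroup E] [InnerProductSpace ℝ E]

/-- `φ` is a feature map of the kernel `K`; kernel ridge regression sees the RKHS only through
such a map. -/
def IsFeatureMap (φ : Z → E) (K : Z → Z → ℝ) : Prop := ∀ x y, inner ℝ (φ x) (φ y) = K x y

/-- The regularized kernel matrix `K + λ² I` of the points `z`. -/
def regGram (K : Z → Z → ℝ) (lam : ℝ) {J : ℕ} (z : Fin J → Z) : Matrix (Fin J) (Fin J) ℝ :=
  gram K z + lam ^ 2 • (1 : Matrix (Fin J) (Fin J) ℝ)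

/-- The weights `(K + λ² I)⁻¹ k(x)` that the ridge regressor at `x` puts on the observations. -/
noncomputable def ridgeWeights (K : Z → Z → ℝ) (lam : ℝ) {J : ℕ} (z : Fin J → Z) (x : Z) :
    Fin J → ℝ :=
  (regGram K lam z)⁻¹ *ᵥ kvec K z x

variable {φ : Z → E} {K : Z → Z → ℝ} {lam : ℝ} {J : ℕ}

theorem IsFeatureMap.symm (h : IsFeatureMap φ K) (x y : Z) : K x y = K y x := by
  rw [← h x y, ← h y x, real_inner_comm]

theorem IsFeatureMap.norm_sq (h : IsFeatureMap φ K) (x : Z) : ‖φ x‖ ^ 2 = K x x := by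
  rw [← h x x, real_inner_self_eq_norm_sq]

theorem IsFeatureMap.diag_nonneg (h : IsFeatureMap φ K) (x : Z) : 0 ≤ K x x :=
  h.norm_sq x ▸ sq_nonneg _

theorem IsFeatureMap.inner_sum (h : IsFeatureMap φ K) (z : Fin J → Z) (w : Fin J → ℝ) (x : Z) :
    inner ℝ (φ x) (∑ i, w i • φ (z i)) = kvec K z x ⬝ᵥ w := by
  simp only [_root_.inner_sum, inner_smul_right, h _ _, kvec, dotProduct]
  exact Finset.sum_congr rfl fun i _ => mul_comm _ _

theorem IsFeatureMap.gram_quadForm (h : IsFeatureMap φ K) (z : Fin J → Z) (w : Fin J → ℝ) :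
    w ⬝ᵥ gram K z *ᵥ w = ‖∑ i, w i • φ (z i)‖ ^ 2 := by
  rw [← real_inner_self_eq_norm_sq, sum_inner]
  refine Finset.sum_congr rfl fun i _ => ?_
  rw [real_inner_smul_left, h.inner_sum]
  rfl

theorem IsFeatureMap.regGram_quadForm (h : IsFeatureMap φ K) (lam : ℝ) (z : Fin J → Z)
    (w : Fin J → ℝ) :
    w ⬝ᵥ regGram K lam z *ᵥ w = ‖∑ i, w i • φ (z i)‖ ^ 2 + lam ^ 2 * (w ⬝ᵥ w) := by
  rw [regGram, add_mulVec, dotProduct_add, h.gram_quadForm, smul_mulVec, one_mulVec,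
    dotProduct_smul, smul_eq_mul]

theorem IsFeatureMap.regGram_transpose (h : IsFeatureMap φ K) (lam : ℝ) (z : Fin J → Z) :
    (regGram K lam z)ᵀ = regGram K lam z := by
  have hgram : (gram K z)ᵀ = gram K z := by
    ext i j
    exact h.symm _ _
  rw [regGram, transpose_add, hgram, transpose_smul, transpose_one]

theorem IsFeatureMap.dotProduct_regGram_mulVec_comm (h : IsFeatureMap φ K) (lam : ℝ)
    (z : Fin J → Z) (v w : Fin J → ℝ) :
    v ⬝ᵥ regGram K lam z *ᵥ w = w ⬝ᵥ regGram K lam z *ᵥ v := by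
  rw [dotProduct_mulVec, ← mulVec_transpose, h.regGram_transpose, dotProduct_comm]

theorem IsFeatureMap.posDef_regGram (h : IsFeatureMap φ K) (hlam : 0 < lam) (z : Fin J → Z) :
    (regGram K lam z).PosDef := by
  refine Matrix.PosDef.of_dotProduct_mulVec_pos ?_ fun w hw => ?_
  · rw [Matrix.IsHermitian, conjTranspose_eq_transpose_of_trivial, h.regGram_transpose]
  · have hww : 0 < w ⬝ᵥ w := dotProduct_self_star_pos_iff.2 hw
    rw [star_trivial, h.regGram_quadForm]
    positivity

theorem IsFeatureMap.isUnit_det_regGram (h : IsFeatureMap φ K) (hlam : 0 < lam)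
    (z : Fin J → Z) : IsUnit (regGram K lam z).det :=
  (h.posDef_regGram hlam z).det_pos.ne'.isUnit

theorem IsFeatureMap.regGram_mulVec_inv (h : IsFeatureMap φ K) (hlam : 0 < lam) (z : Fin J → Z)
    (w : Fin J → ℝ) : regGram K lam z *ᵥ ((regGram K lam z)⁻¹ *ᵥ w) = w := by
  rw [mulVec_mulVec, mul_nonsing_inv _ (h.isUnit_det_regGram hlam z), one_mulVec]

theorem IsFeatureMap.krr_eq_dotProduct_ridgeWeights (h : IsFeatureMap φ K) (lam : ℝ)
    (z : Fin J → Z) (Y : Fin J → ℝ) (x : Z) :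
    krr K lam z Y x = ridgeWeights K lam z x ⬝ᵥ Y := by
  change kvec K z x ⬝ᵥ (regGram K lam z)⁻¹ *ᵥ Y = _
  rw [dotProduct_mulVec, ← mulVec_transpose, transpose_nonsing_inv, h.regGram_transpose]
  rfl

theorem IsFeatureMap.krr_eq_inner (h : IsFeatureMap φ K) (lam : ℝ) (z : Fin J → Z)
    (Y : Fin J → ℝ) (x : Z) :
    krr K lam z Y x = inner ℝ (φ x) (∑ i, ((regGram K lam z)⁻¹ *ᵥ Y) i • φ (z i)) := by
  rw [h.inner_sum]
  rfl

/-- Completing the square: the ridge weights minimize the regularized interpolation error of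
`φ x`, and the squared uncertainty is the minimum. -/
theorem IsFeatureMap.ridge_objective_eq (h : IsFeatureMap φ K) (hlam : 0 < lam) (z : Fin J → Z)
    (x : Z) (w : Fin J → ℝ) :
    ‖φ x - ∑ i, w i • φ (z i)‖ ^ 2 + lam ^ 2 * (w ⬝ᵥ w) =
      uncertaintySq K lam z x +
        (w - ridgeWeights K lam z x) ⬝ᵥ regGram K lam z *ᵥ (w - ridgeWeights K lam z x) := by
  have hv : regGram K lam z *ᵥ ridgeWeights K lam z x = kvec K z x :=
    h.regGram_mulVec_inv hlam z _
  rw [uncertaintySq, h.krr_eq_dotProduct_ridgeWeights, norm_sub_sq_real, h.norm_sq, h.inner_sum,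
    mulVec_sub, sub_dotProduct, dotProduct_sub, dotProduct_sub, hv,
    h.dotProduct_regGram_mulVec_comm lam z (ridgeWeights K lam z x) w, hv, h.regGram_quadForm,
    dotProduct_comm w (kvec K z x)]
  ring

theorem IsFeatureMap.uncertaintySq_eq (h : IsFeatureMap φ K) (hlam : 0 < lam) (z : Fin J → Z)
    (x : Z) :
    uncertaintySq K lam z x = ‖φ x - ∑ i, ridgeWeights K lam z x i • φ (z i)‖ ^ 2 +
      lam ^ 2 * (ridgeWeights K lam z x ⬝ᵥ ridgeWeights K lam z x) := by
  rw [h.ridge_objective_eq hlam z x, sub_self, zero_dotProduct, add_zero]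

theorem IsFeatureMap.uncertaintySq_le (h : IsFeatureMap φ K) (hlam : 0 < lam) (z : Fin J → Z)
    (x : Z) (w : Fin J → ℝ) :
    uncertaintySq K lam z x ≤ ‖φ x - ∑ i, w i • φ (z i)‖ ^ 2 + lam ^ 2 * (w ⬝ᵥ w) := by
  rw [h.ridge_objective_eq hlam z x w]
  exact le_add_of_nonneg_right ((h.posDef_regGram hlam z).posSemidef.dotProduct_mulVec_nonneg _)

theorem IsFeatureMap.ridgeWeights_sq_le (h : IsFeatureMap φ K) (hlam : 0 < lam) (z : Fin J → Z)
    (x : Z) :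
    lam ^ 2 * (ridgeWeights K lam z x ⬝ᵥ ridgeWeights K lam z x) ≤ uncertaintySq K lam z x := by
  rw [h.uncertaintySq_eq hlam]
  exact le_add_of_nonneg_left (by positivity)

theorem IsFeatureMap.norm_sub_ridge_sq_le (h : IsFeatureMap φ K) (hlam : 0 < lam)
    (z : Fin J → Z) (x : Z) :
    ‖φ x - ∑ i, ridgeWeights K lam z x i • φ (z i)‖ ^ 2 ≤ uncertaintySq K lam z x := by
  rw [h.uncertaintySq_eq hlam]
  exact le_add_of_nonneg_right (mul_nonneg (sq_nonneg lam) (dotProduct_self_star_nonneg _))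

theorem IsFeatureMap.uncertaintySq_nonneg (h : IsFeatureMap φ K) (hlam : 0 < lam)
    (z : Fin J → Z) (x : Z) : 0 ≤ uncertaintySq K lam z x :=
  (sq_nonneg _).trans (h.norm_sub_ridge_sq_le hlam z x)

theorem IsFeatureMap.uncertaintySq_le_diag (h : IsFeatureMap φ K) (hlam : 0 < lam)
    (z : Fin J → Z) (x : Z) : uncertaintySq K lam z x ≤ K x x := by
  refine (h.uncertaintySq_le hlam z x 0).trans_eq ?_
  simp [h.norm_sq]

theorem IsFeatureMap.norm_sum_ridgeWeights_smul_le (h : IsFeatureMap φ K) (hlam : 0 < lam)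
    (z : Fin J → Z) (x : Z) :
    ‖∑ j, ridgeWeights K lam z x j • φ (z j)‖ ≤ 2 * ‖φ x‖ := by
  have hresidual : ‖φ x - ∑ j, ridgeWeights K lam z x j • φ (z j)‖ ≤ ‖φ x‖ := by
    refine le_of_sq_le_sq ((h.norm_sub_ridge_sq_le hlam z x).trans ?_) (norm_nonneg _)
    exact (h.uncertaintySq_le_diag hlam z x).trans_eq (h.norm_sq x).symm
  linarith [norm_le_norm_add_norm_sub (φ x) (∑ j, ridgeWeights K lam z x j • φ (z j))]

theorem sum_extend_zero {ι κ M V : Type*} [Zero M] [AddCommMonoid V] [Fintype ι] [Fintype κ]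
    {e : ι → κ} (he : Function.Injective e) (w : ι → M) (g : M → κ → V) (hg : ∀ j, g 0 j = 0) :
    ∑ j, g (Function.extend e w 0 j) j = ∑ i, g (w i) (e i) := by
  refine (Fintype.sum_of_injective e he _ _ (fun j hj => ?_) fun i => ?_).symm
  · rw [Function.extend_apply' _ _ _ fun ⟨i, hi⟩ => hj ⟨i, hi⟩, Pi.zero_apply, hg]
  · rw [he.extend_apply]

theorem IsFeatureMap.uncertaintySq_anti (h : IsFeatureMap φ K) (hlam : 0 < lam) {I : ℕ}
    (z : Fin J → Z) {e : Fin I → Fin J} (he : Function.Injective e) (x : Z) :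
    uncertaintySq K lam z x ≤ uncertaintySq K lam (fun i => z (e i)) x := by
  set w := ridgeWeights K lam (fun i => z (e i)) x
  refine (h.uncertaintySq_le hlam z x (Function.extend e w 0)).trans_eq ?_
  have hφ := sum_extend_zero he w (fun r j => r • φ (z j)) fun _ => zero_smul ℝ _
  have hw := sum_extend_zero he w (fun r _ => r * r) fun _ => mul_zero 0
  rw [h.uncertaintySq_eq hlam]
  simp only [dotProduct]
  rw [hφ, hw]

theorem IsFeatureMap.norm_interpolant_sq_le (h : IsFeatureMap φ K) (hlam : 0 < lam)
    (z : Fin J → Z) (ε : Fin J → ℝ) :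
    lam ^ 2 * ‖∑ i, ((regGram K lam z)⁻¹ *ᵥ ε) i • φ (z i)‖ ^ 2 ≤ ε ⬝ᵥ ε := by
  set α := (regGram K lam z)⁻¹ *ᵥ ε with hα
  have hαε : α ⬝ᵥ ε = ‖∑ i, α i • φ (z i)‖ ^ 2 + lam ^ 2 * (α ⬝ᵥ α) := by
    rw [← h.regGram_quadForm, hα, h.regGram_mulVec_inv hlam]
  have hsq : (ε - lam ^ 2 • α) ⬝ᵥ (ε - lam ^ 2 • α) =
      ε ⬝ᵥ ε - 2 * lam ^ 2 * (α ⬝ᵥ ε) + lam ^ 4 * (α ⬝ᵥ α) := by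
    simp only [sub_dotProduct, dotProduct_sub, smul_dotProduct, dotProduct_smul, smul_eq_mul,
      dotProduct_comm ε α]
    ring
  have hsq_nonneg : 0 ≤ (ε - lam ^ 2 • α) ⬝ᵥ (ε - lam ^ 2 • α) := dotProduct_self_star_nonneg _
  have hαα : 0 ≤ α ⬝ᵥ α := dotProduct_self_star_nonneg α
  rw [hsq, hαε] at hsq_nonneg
  nlinarith [mul_nonneg (sq_nonneg lam) (sq_nonneg ‖∑ i, α i • φ (z i)‖),
    mul_nonneg (sq_nonneg (lam ^ 2)) hαα]

/-! ### The log-determinant and the information gain -/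

theorem one_add_smul_gram (hlam : lam ≠ 0) (K : Z → Z → ℝ) (z : Fin J → Z) :
    1 + (1 / lam ^ 2) • gram K z = (1 / lam ^ 2) • regGram K lam z := by
  rw [regGram, smul_add, smul_smul, one_div_mul_cancel (pow_ne_zero 2 hlam), one_smul, add_comm]

theorem uncertaintySq_eq_schur (K : Z → Z → ℝ) (lam : ℝ) (z : Fin J → Z) (x : Z) :
    uncertaintySq K lam z x = K x x - kvec K z x ⬝ᵥ (regGram K lam z)⁻¹ *ᵥ kvec K z x := rfl

theorem uncertaintySq_eq_diag (K : Z → Z → ℝ) (lam : ℝ) (z : Fin 0 → Z) (x : Z) :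
    uncertaintySq K lam z x = K x x := by
  rw [uncertaintySq_eq_schur, Subsingleton.elim (kvec K z x) 0, zero_dotProduct, sub_zero]

theorem IsFeatureMap.regGram_succ (h : IsFeatureMap φ K) (lam : ℝ) (z : Fin (J + 1) → Z) :
    (regGram K lam z).submatrix finSumFinEquiv finSumFinEquiv =
      fromBlocks (regGram K lam fun i : Fin J => z i.castSucc)
        (replicateCol (Fin 1) (kvec K (fun i : Fin J => z i.castSucc) (z (Fin.last J))))
        (replicateRow (Fin 1) (kvec K (fun i : Fin J => z i.castSucc) (z (Fin.last J))))
        (of fun _ _ => K (z (Fin.last J)) (z (Fin.last J)) + lam ^ 2) := by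
  have hlast (i : Fin 1) : Fin.natAdd J i = Fin.last J := by ext; simp
  have hcast (i : Fin J) : Fin.castAdd 1 i = i.castSucc := rfl
  ext (i | i) (j | j)
  · simp [regGram, gram, one_apply, hcast]
  · simp [regGram, gram, kvec, hlast, hcast, h.symm (z (Fin.last J))]
  · simp [regGram, gram, kvec, hlast, hcast, (Fin.castSucc_ne_last _).symm]
  · simp [regGram, gram, hlast]

theorem IsFeatureMap.det_regGram_succ (h : IsFeatureMap φ K) (hlam : 0 < lam)
    (z : Fin (J + 1) → Z) :
    (regGram K lam z).det = (regGram K lam fun i : Fin J => z i.castSucc).det *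
      (lam ^ 2 + uncertaintySq K lam (fun i : Fin J => z i.castSucc) (z (Fin.last J))) := by
  have : Invertible (regGram K lam fun i : Fin J => z i.castSucc) :=
    invertibleOfIsUnitDet _ (h.isUnit_det_regGram hlam _)
  have hentry (A : Matrix (Fin J) (Fin J) ℝ) (v : Fin J → ℝ) :
      (replicateRow (Fin 1) v * A * replicateCol (Fin 1) v) 0 0 = v ⬝ᵥ A *ᵥ v := by
    rw [Matrix.mul_assoc]
    rfl
  rw [← det_submatrix_equiv_self finSumFinEquiv, h.regGram_succ, det_fromBlocks₁₁, det_fin_one,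
    Matrix.sub_apply, invOf_eq_nonsing_inv, hentry, uncertaintySq_eq_schur, of_apply]
  ring

theorem IsFeatureMap.det_succ (h : IsFeatureMap φ K) (hlam : 0 < lam) (z : Fin (J + 1) → Z) :
    (1 + (1 / lam ^ 2) • gram K z).det =
      (1 + (1 / lam ^ 2) • gram K fun i : Fin J => z i.castSucc).det *
        (1 + 1 / lam ^ 2 *
          uncertaintySq K lam (fun i : Fin J => z i.castSucc) (z (Fin.last J))) := by
  simp only [one_add_smul_gram hlam.ne', det_smul, h.det_regGram_succ hlam, Fintype.card_fin]
  rw [one_div, show 1 + (lam ^ 2)⁻¹ * uncertaintySq K lam (fun i : Fin J => z i.castSucc)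
    (z (Fin.last J)) = (lam ^ 2)⁻¹ * (lam ^ 2 + uncertaintySq K lam
      (fun i : Fin J => z i.castSucc) (z (Fin.last J))) by field_simp, pow_succ]
  ring

theorem IsFeatureMap.det_eq_prod (h : IsFeatureMap φ K) (hlam : 0 < lam) (z : Fin J → Z) :
    (1 + (1 / lam ^ 2) • gram K z).det = ∏ j : Fin J, (1 + 1 / lam ^ 2 *
      uncertaintySq K lam (fun i : Fin j => z (Fin.castLE j.isLt.le i)) (z j)) := by
  induction J with
  | zero => simp
  | succ J ih =>
    rw [h.det_succ hlam, ih, Fin.prod_univ_castSucc]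
    rfl

theorem IsFeatureMap.one_le_one_add_uncertaintySq (h : IsFeatureMap φ K) (hlam : 0 < lam)
    (z : Fin J → Z) (x : Z) : 1 ≤ 1 + 1 / lam ^ 2 * uncertaintySq K lam z x :=
  le_add_of_nonneg_right (mul_nonneg (by positivity) (h.uncertaintySq_nonneg hlam z x))

theorem IsFeatureMap.log_det_le_infoGain (h : IsFeatureMap φ K) (hK : ∀ x, K x x ≤ 1)
    (hlam : 0 < lam) (z : Fin J → Z) :
    Real.log ((1 : Matrix (Fin J) (Fin J) ℝ) + (1 / lam ^ 2) • gram K z).det ≤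
      2 * infoGain K lam J := by
  have hbdd : BddAbove (Set.range fun z : Fin J → Z => 1 / 2 *
      Real.log ((1 : Matrix (Fin J) (Fin J) ℝ) + (1 / lam ^ 2) • gram K z).det) := by
    refine ⟨1 / 2 * Real.log (∏ _j : Fin J, (1 + 1 / lam ^ 2 * 1)),
      Set.forall_mem_range.2 fun z => ?_⟩
    have hpos (j : Fin J) := one_pos.trans_le (h.one_le_one_add_uncertaintySq hlam
      (fun i : Fin j => z (Fin.castLE j.isLt.le i)) (z j))
    rw [h.det_eq_prod hlam]
    gcongr with j
    · exact Finset.prod_pos fun j _ => hpos j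
    · exact fun j _ => (hpos j).le
    · exact (h.uncertaintySq_le_diag hlam _ _).trans (hK _)
  have := le_ciSup hbdd z
  change 1 / 2 * Real.log _ ≤ infoGain K lam J at this
  linarith

theorem IsMaxUncertaintyDesign.mul_log_le_infoGain (h : IsFeatureMap φ K)
    (hK : ∀ x, K x x ≤ 1) (hlam : 0 < lam) {z : Fin J → Z}
    (hz : IsMaxUncertaintyDesign K lam z) (x : Z) :
    J * Real.log (1 + 1 / lam ^ 2 * uncertaintySq K lam z x) ≤ 2 * infoGain K lam J := by
  refine le_trans ?_ (h.log_det_le_infoGain hK hlam z)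
  have hpos := one_pos.trans_le (h.one_le_one_add_uncertaintySq hlam z x)
  rw [← Real.log_pow, h.det_eq_prod hlam, ← Fin.prod_const]
  refine Real.log_le_log (Finset.prod_pos fun _ _ => hpos)
    (Finset.prod_le_prod (fun _ _ => hpos.le) fun j _ => ?_)
  gcongr
  exact (h.uncertaintySq_anti hlam z (Fin.castLE_injective j.isLt.le) x).trans (hz j x)

theorem IsFeatureMap.log_diag_le_infoGain (h : IsFeatureMap φ K) (hK : ∀ x, K x x ≤ 1)
    (hlam : 0 < lam) (hJ : 1 ≤ J) (x : Z) :
    Real.log (1 + 1 / lam ^ 2 * K x x) ≤ 2 * infoGain K lam J := by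
  let first : Fin J := ⟨0, hJ⟩
  have hfirst : uncertaintySq K lam (fun _ : Fin first => x) x = K x x :=
    uncertaintySq_eq_diag K lam _ x
  have hdiag := h.diag_nonneg x
  refine (Real.log_le_log (by positivity) ?_).trans
    (h.log_det_le_infoGain hK hlam fun _ : Fin J => x)
  rw [h.det_eq_prod hlam, ← Finset.mul_prod_erase _ _ (Finset.mem_univ first), hfirst]
  exact le_mul_of_one_le_right (by positivity)
    (Finset.one_le_prod fun j _ => h.one_le_one_add_uncertaintySq hlam _ x)

theorem IsMaxUncertaintyDesign.exists_uncertaintySq_le_sq (h : IsFeatureMap φ K)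
    (hK : ∀ x, K x x ≤ 1) (hlam : 0 < lam) (hJ : 1 ≤ J) {z : Fin J → Z}
    (hz : IsMaxUncertaintyDesign K lam z) :
    ∃ u, 0 ≤ u ∧ u ≤ 1 ∧ (∀ x, uncertaintySq K lam z x ≤ u ^ 2) ∧
      J * Real.log (1 + 1 / lam ^ 2 * u ^ 2) ≤ 2 * infoGain K lam J := by
  have hJ' : (0 : ℝ) < J := Nat.cast_pos.2 hJ
  set s := (Real.exp (2 * infoGain K lam J / J) - 1) * lam ^ 2
  have hs (t : ℝ) (ht : 0 ≤ t) :
      J * Real.log (1 + 1 / lam ^ 2 * t) ≤ 2 * infoGain K lam J ↔ t ≤ s := by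
    rw [← le_div_iff₀' hJ', Real.log_le_iff_le_exp (by positivity), one_div_mul_eq_div,
      ← le_sub_iff_add_le', div_le_iff₀ (by positivity)]
  have huncertainty (x : Z) : uncertaintySq K lam z x ≤ min 1 s :=
    le_min ((h.uncertaintySq_le_diag hlam z x).trans (hK x))
      ((hs _ (h.uncertaintySq_nonneg hlam z x)).1 (hz.mul_log_le_infoGain h hK hlam x))
  have hnonneg : 0 ≤ min 1 s :=
    (h.uncertaintySq_nonneg hlam z (z ⟨0, hJ⟩)).trans (huncertainty _)
  refine ⟨√(min 1 s), Real.sqrt_nonneg _, Real.sqrt_le_one.2 (min_le_left _ _), ?_, ?_⟩ <;>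
    rw [Real.sq_sqrt hnonneg]
  · exact huncertainty
  · exact (hs _ hnonneg).2 (min_le_right _ _)

end RidgeRegression

/-! ### Performance difference -/

namespace MDP

variable {S A : Type*} [MeasurableSpace S] [MeasurableSpace A]

/-- The law of the state-action pair `(s_t, a_t)` under the policy `π` with `s₀ = s`. -/
noncomputable def lawAt (M : MDP S A) (π : Policy S A) (s : S) (t : ℕ) : Measure (S × A) :=
  (M.trajLaw π s).map fun ω => ω t

/-- The expectation of `W` at the next state. -/
noncomputable def nextExp (M : MDP S A) (W : S → ℝ) (z : S × A) : ℝ := ∫ s', W s' ∂(M.P z)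

/-- The Bellman advantage of the pair `z` with respect to the function `W`. -/
noncomputable def advantage (M : MDP S A) (W : S → ℝ) (z : S × A) : ℝ :=
  M.r z + M.γ * M.nextExp W z - W z.1

instance (M : MDP S A) (π : Policy S A) (s : S) : IsProbabilityMeasure (M.trajLaw π s) := by
  unfold trajLaw
  infer_instance

instance (M : MDP S A) (π : Policy S A) (s : S) (t : ℕ) :
    IsProbabilityMeasure (M.lawAt π s t) :=
  Measure.isProbabilityMeasure_map (measurable_pi_apply t).aemeasurable

theorem lawAt_zero (M : MDP S A) (π : Policy S A) (s : S) :
    M.lawAt π s 0 = (Measure.dirac s) ⊗ₘ π.1 := by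
  have hinit : (M.trajLaw π s).map (Preorder.frestrictLe 0) = ((Measure.dirac s) ⊗ₘ π.1).map
      (MeasurableEquiv.piUnique (fun _ : Finset.Iic 0 => S × A)).symm := by
    unfold trajLaw Kernel.trajMeasure
    rw [Measure.map_comp _ _ (by fun_prop), Kernel.traj_map_frestrictLe, Kernel.partialTraj_self,
      Measure.id_comp]
  have hmap : M.lawAt π s 0 = ((M.trajLaw π s).map (Preorder.frestrictLe 0)).map
      fun h => h ⟨0, Finset.mem_Iic.2 le_rfl⟩ := by
    rw [Measure.map_map (by fun_prop) (by fun_prop)]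
    rfl
  rw [hmap, hinit, Measure.map_map (by fun_prop) (by fun_prop)]
  exact Measure.map_id

theorem lawAt_succ (M : MDP S A) (π : Policy S A) (s : S) (t : ℕ) :
    M.lawAt π s (t + 1) = M.step π ∘ₘ M.lawAt π s t := by
  have hmap : M.lawAt π s (t + 1) =
      ((M.trajLaw π s).map (Preorder.frestrictLe t) ⊗ₘ M.historyStep π t).map Prod.snd := by
    unfold trajLaw
    rw [Kernel.map_frestrictLe_trajMeasure_compProd_eq_map_trajMeasure,
      Measure.map_map (by fun_prop) (by fun_prop)]
    rfl
  ext B hB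
  rw [hmap, ← Measure.snd, Measure.snd_compProd, Measure.bind_apply hB (Kernel.aemeasurable _),
    Measure.bind_apply hB (Kernel.aemeasurable _), lawAt,
    lintegral_map (Kernel.measurable_coe _ hB) (by fun_prop),
    lintegral_map (Kernel.measurable_coe _ hB) (by fun_prop)]
  rfl

theorem ae_lawAt (M : MDP S A) (π : Policy S A) (s : S) (t : ℕ) {p : S × A → Prop}
    (hp : MeasurableSet {z | p z}) (h : ∀ s, ∀ᵐ a ∂(π.1 s), p (s, a)) :
    ∀ᵐ z ∂(M.lawAt π s t), p z := by
  cases t with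
  | zero =>
    rw [lawAt_zero, Measure.ae_compProd_iff hp]
    exact .of_forall h
  | succ t =>
    rw [lawAt_succ, Measure.ae_comp_iff hp]
    refine .of_forall fun z => ?_
    rw [step, Kernel.ae_compProd_iff hp]
    exact .of_forall h

theorem integral_fst_lawAt_zero (M : MDP S A) (π : Policy S A) (s : S) {W : S → ℝ}
    (hW : Measurable W) : ∫ z, W z.1 ∂(M.lawAt π s 0) = W s := by
  have hmap : ∫ z, W z.1 ∂(M.lawAt π s 0) = ∫ x, W x ∂((M.lawAt π s 0).map Prod.fst) := by
    rw [integral_map (by fun_prop) hW.aestronglyMeasurable]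
  rw [hmap, lawAt_zero, ← Measure.fst, Measure.fst_compProd,
    integral_dirac' _ _ hW.stronglyMeasurable]

theorem integral_fst_lawAt_succ (M : MDP S A) (π : Policy S A) (s : S) (t : ℕ) {W : S → ℝ}
    (hW : Measurable W) {b : ℝ} (hb : ∀ s, |W s| ≤ b) :
    ∫ z, W z.1 ∂(M.lawAt π s (t + 1)) = ∫ z, M.nextExp W z ∂(M.lawAt π s t) := by
  have hstep (z : S × A) : ∫ x, W x.1 ∂(M.step π z) = M.nextExp W z := by
    have hmap : ∫ x, W x.1 ∂(M.step π z) = ∫ x, W x ∂((M.step π z).map Prod.fst) := by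
      rw [integral_map (by fun_prop) hW.aestronglyMeasurable]
    rw [hmap, ← Kernel.fst_apply, step, Kernel.fst_compProd]
    rfl
  have hinteg : Integrable (fun z : S × A => W z.1) (M.lawAt π s (t + 1)) :=
    .of_bound (hW.comp measurable_fst).aestronglyMeasurable b (.of_forall fun z => hb z.1)
  rw [lawAt_succ] at hinteg ⊢
  have hprod := Measure.integral_compProd
    ((Measure.integrable_compProd_snd_iff hinteg.aestronglyMeasurable).2 hinteg)
  rw [← Measure.snd_compProd] at hinteg ⊢
  rw [Measure.snd, integral_map (by fun_prop) hinteg.aestronglyMeasurable, hprod]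
  simp only [hstep]

section Bounds

variable (M : MDP S A) {W : S → ℝ} {b : ℝ}

theorem abs_r_le (z : S × A) : |M.r z| ≤ 1 := by
  rw [abs_of_nonneg (M.r_nonneg z)]
  exact M.r_le_one z

theorem measurable_nextExp (hW : Measurable W) : Measurable (M.nextExp W) :=
  (StronglyMeasurable.integral_kernel_prod_right (f := fun _ s' => W s')
    (hW.comp measurable_snd).stronglyMeasurable).measurable

theorem abs_nextExp_le (hb : ∀ s, |W s| ≤ b) (z : S × A) : |M.nextExp W z| ≤ b := by
  simpa [nextExp] using norm_integral_le_of_norm_le_const (μ := M.P z) (f := W) (.of_forall hb)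

theorem measurable_advantage (hW : Measurable W) : Measurable (M.advantage W) :=
  (M.measurable_r.add ((M.measurable_nextExp hW).const_mul _)).sub (hW.comp measurable_fst)

variable (μ : Measure (S × A)) [IsFiniteMeasure μ]

theorem integrable_r : Integrable M.r μ :=
  .of_bound M.measurable_r.aestronglyMeasurable 1 (.of_forall M.abs_r_le)

theorem integrable_nextExp (hW : Measurable W) (hb : ∀ s, |W s| ≤ b) :
    Integrable (M.nextExp W) μ :=
  .of_bound (M.measurable_nextExp hW).aestronglyMeasurable b (.of_forall (M.abs_nextExp_le hb))

theorem integrable_advantage (hW : Measurable W) (hb : ∀ s, |W s| ≤ b) :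
    Integrable (M.advantage W) μ :=
  ((M.integrable_r μ).add ((M.integrable_nextExp μ hW hb).const_mul _)).sub
    (.of_bound (hW.comp measurable_fst).aestronglyMeasurable b (.of_forall fun z => hb z.1))

end Bounds

theorem integral_advantage_lawAt (M : MDP S A) (π : Policy S A) (s : S) (t : ℕ) {W : S → ℝ}
    (hW : Measurable W) {b : ℝ} (hb : ∀ s, |W s| ≤ b) :
    ∫ z, M.advantage W z ∂(M.lawAt π s t) =
      ∫ z, M.r z ∂(M.lawAt π s t) + M.γ * ∫ z, W z.1 ∂(M.lawAt π s (t + 1)) -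
        ∫ z, W z.1 ∂(M.lawAt π s t) := by
  have hr := M.integrable_r (M.lawAt π s t)
  have hn := (M.integrable_nextExp (M.lawAt π s t) hW hb).const_mul M.γ
  have hw : Integrable (fun z : S × A => W z.1) (M.lawAt π s t) :=
    .of_bound (hW.comp measurable_fst).aestronglyMeasurable b (.of_forall fun z => hb z.1)
  rw [M.integral_fst_lawAt_succ π s t hW hb, ← integral_const_mul, ← integral_add hr hn]
  exact integral_sub (hr.add hn) hw

theorem hasSum_value (M : MDP S A) (π : Policy S A) (s : S) :
    HasSum (fun t => M.γ ^ t * ∫ z, M.r z ∂(M.lawAt π s t)) (M.value π s) := by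
  have hγ := M.γ_pos
  have hbound (t : ℕ) (ω : ℕ → S × A) : ‖M.γ ^ t * M.r (ω t)‖ ≤ M.γ ^ t := by
    rw [norm_mul, Real.norm_of_nonneg (by positivity)]
    exact mul_le_of_le_one_right (by positivity) (M.abs_r_le _)
  have hinteg (t : ℕ) : Integrable (fun ω => M.γ ^ t * M.r (ω t)) (M.trajLaw π s) :=
    .of_bound ((M.measurable_r.comp (measurable_pi_apply t)).const_mul _).aestronglyMeasurable
      (M.γ ^ t) (.of_forall (hbound t))
  have hsum : Summable fun t => ∫ ω, ‖M.γ ^ t * M.r (ω t)‖ ∂(M.trajLaw π s) := by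
    refine (summable_geometric_of_lt_one hγ.le M.γ_lt_one).of_nonneg_of_le
      (fun t => integral_nonneg fun ω => norm_nonneg _) fun t => ?_
    simpa using integral_mono (hinteg t).norm (integrable_const (M.γ ^ t)) (hbound t)
  have hterm (t : ℕ) : M.γ ^ t * ∫ z, M.r z ∂(M.lawAt π s t) =
      ∫ ω, M.γ ^ t * M.r (ω t) ∂(M.trajLaw π s) := by
    rw [integral_const_mul, lawAt, integral_map (measurable_pi_apply t).aemeasurable
      M.measurable_r.aestronglyMeasurable]
  simp only [hterm]
  exact hasSum_integral_of_summable_integral_norm hinteg hsum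

theorem hasSum_discounted_telescope (M : MDP S A) (π : Policy S A) (s : S) {W : S → ℝ}
    (hW : Measurable W) {b : ℝ} (hb : ∀ s, |W s| ≤ b) :
    HasSum (fun t => M.γ ^ (t + 1) * ∫ z, W z.1 ∂(M.lawAt π s (t + 1)) -
      M.γ ^ t * ∫ z, W z.1 ∂(M.lawAt π s t)) (-W s) := by
  have hγ := M.γ_pos
  have hs : Summable fun t => M.γ ^ t * ∫ z, W z.1 ∂(M.lawAt π s t) := by
    refine .of_norm_bounded (g := fun t => M.γ ^ t * b)
      ((summable_geometric_of_lt_one hγ.le M.γ_lt_one).mul_right b) fun t => ?_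
    rw [norm_mul, Real.norm_of_nonneg (by positivity)]
    gcongr
    simpa using norm_integral_le_of_norm_le_const (μ := M.lawAt π s t)
      (f := fun z : S × A => W z.1) (.of_forall fun z => hb z.1)
  simpa [M.integral_fst_lawAt_zero π s hW] using
    ((hasSum_nat_add_iff' 1).2 hs.hasSum).sub hs.hasSum

/-- **Performance difference identity**: the discounted expectations of `W` telescope to `-W s`,
and adding them to the series of the value turns every reward into an advantage. -/
theorem hasSum_value_sub (M : MDP S A) (π : Policy S A) (s : S) {W : S → ℝ}
    (hW : Measurable W) {b : ℝ} (hb : ∀ s, |W s| ≤ b) :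
    HasSum (fun t => M.γ ^ t * ∫ z, M.advantage W z ∂(M.lawAt π s t)) (M.value π s - W s) := by
  convert (M.hasSum_value π s).add (M.hasSum_discounted_telescope π s hW hb) using 1
  · funext t
    rw [M.integral_advantage_lawAt π s t hW hb]
    ring
  · ring

theorem value_le_add (M : MDP S A) (π : Policy S A) (s : S) {W : S → ℝ}
    (hW : Measurable W) {b : ℝ} (hb : ∀ s, |W s| ≤ b) {η : ℝ}
    (hη : ∀ z, M.advantage W z ≤ η) : M.value π s ≤ W s + η / (1 - M.γ) := by
  have hγ := M.γ_pos
  have hle := hasSum_le (fun t => ?_) (M.hasSum_value_sub π s hW hb)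
    ((hasSum_geometric_of_lt_one hγ.le M.γ_lt_one).mul_right η)
  · rw [div_eq_inv_mul]
    linarith
  · gcongr
    simpa using integral_mono (M.integrable_advantage (M.lawAt π s t) hW hb)
      (integrable_const η) hη

theorem sub_le_value (M : MDP S A) (π : Policy S A) (s : S) {W : S → ℝ}
    (hW : Measurable W) {b : ℝ} (hb : ∀ s, |W s| ≤ b) {η : ℝ}
    (hη : ∀ s, ∀ᵐ a ∂(π.1 s), -η ≤ M.advantage W (s, a)) :
    W s - η / (1 - M.γ) ≤ M.value π s := by
  have hγ := M.γ_pos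
  have hle := hasSum_le (fun t => ?_)
    ((hasSum_geometric_of_lt_one hγ.le M.γ_lt_one).mul_right (-η)) (M.hasSum_value_sub π s hW hb)
  · rw [div_eq_inv_mul]
    linarith
  · gcongr
    simpa using integral_mono_ae (integrable_const (-η))
      (M.integrable_advantage (M.lawAt π s t) hW hb)
      (M.ae_lawAt π s t (measurableSet_le measurable_const (M.measurable_advantage hW)) hη)

end MDP

/-! ### Value iteration -/

section CompactSup

variable {A : Type*} [TopologicalSpace A]

theorem measurable_iSup_of_continuous {X : Type*} [MeasurableSpace X]
    [TopologicalSpace.SeparableSpace A] {F : X → A → ℝ} (hm : ∀ a, Measurable fun x => F x a)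
    (hc : ∀ x, Continuous (F x)) : Measurable fun x => ⨆ a, F x a := by
  obtain ⟨T, hT, hd⟩ := TopologicalSpace.exists_countable_dense A
  have : Countable T := hT.to_subtype
  have hsup : (fun x => ⨆ a, F x a) = fun x => ⨆ a : T, F x a :=
    funext fun x => (hd.ciSup' (hc x)).symm
  rw [hsup]
  exact Measurable.iSup fun a => hm a

variable [CompactSpace A]

theorem le_ciSup_of_continuous {F : A → ℝ} (hF : Continuous F) (a : A) : F a ≤ ⨆ a, F a :=
  le_ciSup (isCompact_range hF).bddAbove a

theorem abs_ciSup_sub_le [Nonempty A] {F G : A → ℝ} (hF : Continuous F) (hG : Continuous G)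
    {η : ℝ} (h : ∀ a, |F a - G a| ≤ η) : |(⨆ a, F a) - ⨆ a, G a| ≤ η := by
  rw [abs_sub_le_iff, sub_le_iff_le_add, sub_le_iff_le_add]
  constructor
  · exact ciSup_le fun a => by
      linarith [le_ciSup_of_continuous hG a, (abs_sub_le_iff.1 (h a)).1]
  · exact ciSup_le fun a => by
      linarith [le_ciSup_of_continuous hF a, (abs_sub_le_iff.1 (h a)).2]

end CompactSup

namespace MDP

section Clip

variable {S A : Type*} [MeasurableSpace S] [MeasurableSpace A] (M : MDP S A)

/-- The projection onto the interval `[0, 1 / (1 - γ)]` of possible values. -/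
noncomputable def clip (x : ℝ) : ℝ := max 0 (min (1 / (1 - M.γ)) x)

/-- The clipped greedy value `max_a Q (s, a)` of a Q-function: one round of the algorithm observes
it at a sampled state. -/
noncomputable def clippedValue (Q : S × A → ℝ) (s : S) : ℝ := M.clip (⨆ a : A, Q (s, a))

theorem one_sub_γ_pos : 0 < 1 - M.γ := sub_pos.2 M.γ_lt_one

theorem clip_nonneg (x : ℝ) : 0 ≤ M.clip x := le_max_left _ _

theorem clip_le (x : ℝ) : M.clip x ≤ 1 / (1 - M.γ) :=
  max_le (one_div_nonneg.2 M.one_sub_γ_pos.le) (min_le_left _ _)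

theorem clip_eq_self {x : ℝ} (h0 : 0 ≤ x) (h1 : x ≤ 1 / (1 - M.γ)) : M.clip x = x := by
  rw [clip, min_eq_right h1, max_eq_right h0]

theorem abs_clip_sub_le (x y : ℝ) : |M.clip x - M.clip y| ≤ |x - y| := by
  unfold clip
  rw [max_comm 0, max_comm 0, min_comm _ x, min_comm _ y]
  exact (abs_max_sub_max_le_abs _ _ _).trans (abs_inf_sub_inf_le_abs x y (1 / (1 - M.γ)))

theorem measurable_clip : Measurable M.clip :=
  measurable_const.max (measurable_const.min measurable_id)

theorem abs_clippedValue_le (Q : S × A → ℝ) (s : S) :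
    |M.clippedValue Q s| ≤ 1 / (1 - M.γ) := by
  rw [clippedValue, abs_of_nonneg (M.clip_nonneg _)]
  exact M.clip_le _

end Clip

section ValueIteration

variable {S A : Type*} [MeasurableSpace S] [MeasurableSpace A]

/-- The Q-function `r + γ P W` of a continuation value `W`. -/
noncomputable def backup (M : MDP S A) (W : S → ℝ) (z : S × A) : ℝ := M.r z + M.γ * M.nextExp W z

/-- Value iteration `W ↦ max_a (r + γ P W) (·, a)` started at `0`: the noiseless version of the
algorithm. -/
noncomputable def valueIter (M : MDP S A) : ℕ → S → ℝ
  | 0 => 0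
  | n + 1 => fun s => ⨆ a : A, M.backup (valueIter M n) (s, a)

/-- Rewards and expected next values are continuous in the action, so that on a compact action
space the maxima in value iteration are attained. -/
structure IsActionContinuous [TopologicalSpace A] (M : MDP S A) : Prop where
  continuous_r (s : S) : Continuous fun a => M.r (s, a)
  continuous_nextExp {W : S → ℝ} (hW : Measurable W) {b : ℝ} (hb : ∀ s, |W s| ≤ b) (s : S) :
    Continuous fun a => M.nextExp W (s, a)

section Backup

variable (M : MDP S A) {V W : S → ℝ} (hV : Measurable V) (hW : Measurable W) {b : ℝ}
  (hVb : ∀ s, |V s| ≤ b) (hWb : ∀ s, |W s| ≤ b)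
include hV hW hVb hWb

theorem nextExp_le_add {η : ℝ} (h : ∀ s, V s ≤ W s + η) (z : S × A) :
    M.nextExp V z ≤ M.nextExp W z + η := by
  have hVi : Integrable V (M.P z) := .of_bound hV.aestronglyMeasurable b (.of_forall hVb)
  have hWi : Integrable W (M.P z) := .of_bound hW.aestronglyMeasurable b (.of_forall hWb)
  calc M.nextExp V z ≤ ∫ s, W s + η ∂(M.P z) :=
        integral_mono hVi (hWi.add (integrable_const η)) h
    _ = M.nextExp W z + η := by
        rw [integral_add hWi (integrable_const η)]
        simp [nextExp]

theorem abs_backup_sub_backup_le {e : ℝ} (h : ∀ s, |V s - W s| ≤ e) (z : S × A) :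
    |M.backup V z - M.backup W z| ≤ M.γ * e := by
  have hVW := M.nextExp_le_add hV hW hVb hWb (η := e)
    (fun s => by linarith [(abs_sub_le_iff.1 (h s)).1]) z
  have hWV := M.nextExp_le_add hW hV hWb hVb (η := e)
    (fun s => by linarith [(abs_sub_le_iff.1 (h s)).2]) z
  rw [backup, backup, add_sub_add_left_eq_sub, ← mul_sub, abs_mul, abs_of_pos M.γ_pos]
  exact mul_le_mul_of_nonneg_left
    (abs_sub_le_iff.2 ⟨by linarith, by linarith⟩) M.γ_pos.le

end Backup

theorem measurable_backup (M : MDP S A) {W : S → ℝ} (hW : Measurable W) :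
    Measurable (M.backup W) :=
  M.measurable_r.add ((M.measurable_nextExp hW).const_mul _)

theorem backup_zero (M : MDP S A) : M.backup 0 = M.r := by
  ext z
  simp [backup, nextExp]

theorem backup_nonneg (M : MDP S A) {W : S → ℝ} (hW : ∀ s, 0 ≤ W s) (z : S × A) :
    0 ≤ M.backup W z :=
  add_nonneg (M.r_nonneg z) (mul_nonneg M.γ_pos.le (integral_nonneg hW))

theorem backup_le_of_abs_le (M : MDP S A) {W : S → ℝ} (hW : ∀ s, |W s| ≤ 1 / (1 - M.γ))
    (z : S × A) : M.backup W z ≤ 1 / (1 - M.γ) := by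
  have hγ := M.one_sub_γ_pos
  calc M.backup W z ≤ 1 + M.γ * (1 / (1 - M.γ)) :=
        add_le_add (M.r_le_one z)
          (mul_le_mul_of_nonneg_left (abs_le.1 (M.abs_nextExp_le hW z)).2 M.γ_pos.le)
    _ = 1 / (1 - M.γ) := by field_simp; ring

variable [TopologicalSpace A] {M : MDP S A}

theorem measurable_clippedValue [TopologicalSpace.SeparableSpace A] {Q : S × A → ℝ}
    (hQm : Measurable Q) (hQc : ∀ s, Continuous fun a => Q (s, a)) :
    Measurable (M.clippedValue Q) :=
  M.measurable_clip.comp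
    (measurable_iSup_of_continuous (fun _ => hQm.comp measurable_prodMk_right) hQc)

namespace IsActionContinuous

variable (hM : M.IsActionContinuous)
include hM

theorem continuous_backup {W : S → ℝ} (hW : Measurable W) {b : ℝ} (hb : ∀ s, |W s| ≤ b) (s : S) :
    Continuous fun a => M.backup W (s, a) :=
  (hM.continuous_r s).add ((hM.continuous_nextExp hW hb s).const_mul _)

variable [CompactSpace A] [Nonempty A] [TopologicalSpace.SeparableSpace A]

theorem valueIter_spec (n : ℕ) :
    Measurable (M.valueIter n) ∧ ∀ s, M.valueIter n s ∈ Set.Icc 0 (1 / (1 - M.γ)) := by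
  induction n with
  | zero => exact ⟨measurable_const, fun s => ⟨le_rfl, one_div_nonneg.2 M.one_sub_γ_pos.le⟩⟩
  | succ n ih =>
    obtain ⟨hm, hIcc⟩ := ih
    have hb (s : S) : |M.valueIter n s| ≤ 1 / (1 - M.γ) :=
      (abs_of_nonneg (hIcc s).1).trans_le (hIcc s).2
    have hc := hM.continuous_backup hm hb
    refine ⟨measurable_iSup_of_continuous
      (fun a => (M.measurable_backup hm).comp measurable_prodMk_right) hc, fun s => ⟨?_, ?_⟩⟩
    · obtain ⟨a⟩ := ‹Nonempty A›
      exact (M.backup_nonneg (fun s => (hIcc s).1) (s, a)).trans (le_ciSup_of_continuous (hc s) a)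
    · exact ciSup_le fun a => M.backup_le_of_abs_le hb (s, a)

theorem measurable_valueIter (n : ℕ) : Measurable (M.valueIter n) := (hM.valueIter_spec n).1

theorem abs_valueIter_le (n : ℕ) (s : S) : |M.valueIter n s| ≤ 1 / (1 - M.γ) := by
  obtain ⟨hnonneg, hle⟩ := (hM.valueIter_spec n).2 s
  rwa [abs_of_nonneg hnonneg]

theorem continuous_backup_valueIter (n : ℕ) (s : S) :
    Continuous fun a => M.backup (M.valueIter n) (s, a) :=
  hM.continuous_backup (hM.measurable_valueIter n) (hM.abs_valueIter_le n) s

theorem backup_le_valueIter_succ (n : ℕ) (z : S × A) :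
    M.backup (M.valueIter n) z ≤ M.valueIter (n + 1) z.1 :=
  le_ciSup_of_continuous (hM.continuous_backup_valueIter n z.1) z.2

theorem valueIter_le_succ (n : ℕ) (s : S) : M.valueIter n s ≤ M.valueIter (n + 1) s := by
  induction n generalizing s with
  | zero => exact ((hM.valueIter_spec 1).2 s).1
  | succ n ih =>
    refine ciSup_le fun a => le_trans ?_ (hM.backup_le_valueIter_succ (n + 1) (s, a))
    have hmono := M.nextExp_le_add (hM.measurable_valueIter n) (hM.measurable_valueIter (n + 1))
      (hM.abs_valueIter_le n) (hM.abs_valueIter_le (n + 1)) (η := 0) (by simpa using ih) (s, a)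
    rw [add_zero] at hmono
    exact add_le_add_right (mul_le_mul_of_nonneg_left hmono M.γ_pos.le) _

theorem valueIter_succ_le (n : ℕ) (s : S) :
    M.valueIter (n + 1) s ≤ M.valueIter n s + M.γ ^ n := by
  induction n generalizing s with
  | zero =>
    refine ciSup_le fun a => ?_
    simpa [valueIter, backup_zero] using M.r_le_one (s, a)
  | succ n ih =>
    refine ciSup_le fun a => ?_
    have hexp := M.nextExp_le_add (hM.measurable_valueIter (n + 1)) (hM.measurable_valueIter n)
      (hM.abs_valueIter_le (n + 1)) (hM.abs_valueIter_le n) ih (s, a)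
    calc M.backup (M.valueIter (n + 1)) (s, a)
        ≤ M.r (s, a) + M.γ * (M.nextExp (M.valueIter n) (s, a) + M.γ ^ n) :=
          add_le_add_right (mul_le_mul_of_nonneg_left hexp M.γ_pos.le) _
      _ = M.backup (M.valueIter n) (s, a) + M.γ ^ (n + 1) := by rw [backup]; ring
      _ ≤ M.valueIter (n + 1) s + M.γ ^ (n + 1) :=
          add_le_add_left (hM.backup_le_valueIter_succ n (s, a)) _

theorem value_le_valueIter_add (n : ℕ) (π : Policy S A) (s : S) :
    M.value π s ≤ M.valueIter n s + M.γ ^ n / (1 - M.γ) := by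
  refine M.value_le_add π s (hM.measurable_valueIter n) (hM.abs_valueIter_le n) fun z => ?_
  have hbackup := hM.backup_le_valueIter_succ n z
  have hsucc := hM.valueIter_succ_le n z.1
  rw [backup] at hbackup
  rw [advantage]
  linarith

theorem valueIter_sub_le_value (n : ℕ) {π : Policy S A} {Q : S × A → ℝ} (hQ : IsGreedy π Q)
    {e : ℝ} (he : ∀ z, |Q z - M.backup (M.valueIter n) z| ≤ e) (s : S) :
    M.valueIter n s - 2 * e / (1 - M.γ) ≤ M.value π s := by
  refine M.sub_le_value π s (hM.measurable_valueIter n) (hM.abs_valueIter_le n) fun s => ?_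
  filter_upwards [hQ s] with a hgreedy
  have hsup : M.valueIter (n + 1) s ≤ Q (s, a) + e := ciSup_le fun a' => by
    linarith [hgreedy a', (abs_le.1 (he (s, a'))).1]
  have hmono := hM.valueIter_le_succ n s
  have hQa := (abs_le.1 (he (s, a))).2
  rw [backup] at hQa
  rw [advantage]
  linarith

theorem abs_value_sub_optValue_le (n : ℕ) {π : Policy S A} {Q : S × A → ℝ} (hQ : IsGreedy π Q)
    {e : ℝ} (he : ∀ z, |Q z - M.backup (M.valueIter n) z| ≤ e) (s : S) :
    |M.value π s - M.optValue s| ≤ 2 * e / (1 - M.γ) + M.γ ^ n / (1 - M.γ) := by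
  have : Nonempty (Policy S A) := ⟨π⟩
  have hgreedy := hM.valueIter_sub_le_value n hQ he s
  have hupper (π' : Policy S A) := hM.value_le_valueIter_add n π' s
  have hopt : M.optValue s ≤ M.valueIter n s + M.γ ^ n / (1 - M.γ) := ciSup_le hupper
  have hπ : M.value π s ≤ M.optValue s :=
    le_ciSup ⟨_, Set.forall_mem_range.2 hupper⟩ π
  rw [abs_sub_comm, abs_of_nonneg (sub_nonneg.2 hπ)]
  linarith

theorem abs_clippedValue_sub_valueIter_succ_le (n : ℕ) {Q : S × A → ℝ}
    (hQc : ∀ s, Continuous fun a => Q (s, a)) {e : ℝ}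
    (he : ∀ z, |Q z - M.backup (M.valueIter n) z| ≤ e) (s : S) :
    |M.clippedValue Q s - M.valueIter (n + 1) s| ≤ e := by
  obtain ⟨hnonneg, hle⟩ := (hM.valueIter_spec (n + 1)).2 s
  rw [← M.clip_eq_self hnonneg hle]
  exact (M.abs_clip_sub_le _ _).trans
    (abs_ciSup_sub_le (hQc s) (hM.continuous_backup_valueIter n s) fun a => he (s, a))

theorem abs_sub_backup_valueIter_succ_le (n : ℕ) {Q Q' : S × A → ℝ} (hQm : Measurable Q)
    (hQc : ∀ s, Continuous fun a => Q (s, a)) {e e' : ℝ}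
    (he : ∀ z, |Q z - M.backup (M.valueIter n) z| ≤ e)
    (he' : ∀ z, |Q' z - M.backup (M.clippedValue Q) z| ≤ e') (z : S × A) :
    |Q' z - M.backup (M.valueIter (n + 1)) z| ≤ e' + M.γ * e :=
  (abs_sub_le _ _ _).trans <| add_le_add (he' z) <|
    M.abs_backup_sub_backup_le (measurable_clippedValue hQm hQc) (hM.measurable_valueIter (n + 1))
      (M.abs_clippedValue_le Q) (hM.abs_valueIter_le (n + 1))
      (hM.abs_clippedValue_sub_valueIter_succ_le n hQc he) z

end IsActionContinuous

end ValueIteration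

end MDP

/-! ### The feature map of the RKHS and the transition density -/

section Feature

variable {Z H : Type*} [NormedAddCommGroup H] [InnerProductSpace ℝ H] [CompleteSpace H]
  [RKHS ℝ H Z ℝ]

/-- The canonical feature map `x ↦ K(·, x)` of a reproducing kernel Hilbert space. -/
noncomputable def feature (H : Type*) [NormedAddCommGroup H] [InnerProductSpace ℝ H]
    [CompleteSpace H] [RKHS ℝ H Z ℝ] (x : Z) : H := RKHS.kerFun H x (1 : ℝ)

theorem inner_feature (x : Z) (f : H) : inner ℝ (feature H x) f = f x := by
  simp [feature, RKHS.kerFun_inner]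

theorem IsRKHSOf.isFeatureMap {K : Z → Z → ℝ} (h : IsRKHSOf H K) :
    IsFeatureMap (feature H) K := fun x y => by
  rw [inner_feature, feature, RKHS.kerFun_apply, h x y]

theorem IsFeatureMap.continuous {E : Type*} [NormedAddCommGroup E] [InnerProductSpace ℝ E]
    [TopologicalSpace Z] {φ : Z → E} {K : Z → Z → ℝ} (h : IsFeatureMap φ K)
    (hK : Continuous (Function.uncurry K)) : Continuous φ := by
  refine continuous_iff_continuousAt.2 fun x => ?_
  rw [ContinuousAt, tendsto_iff_norm_sub_tendsto_zero]
  have hdist : Continuous fun y => √(K y y - 2 * K y x + K x x) :=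
    (((hK.comp (continuous_id.prodMk continuous_id)).sub
      ((hK.comp (continuous_id.prodMk continuous_const)).const_mul 2)).add_const (K x x)).sqrt
  have hlim := hdist.tendsto x
  rw [show K x x - 2 * K x x + K x x = 0 by ring, Real.sqrt_zero] at hlim
  refine hlim.congr fun y => ?_
  rw [← h.norm_sq, ← h.norm_sq, ← h y x, ← norm_sub_sq_real, Real.sqrt_sq (norm_nonneg _)]

end Feature

namespace HasBoundedDensity

variable {S A G : Type*} [MeasurableSpace S] [MeasurableSpace A] [NormedAddCommGroup G]
  [InnerProductSpace ℝ G] [CompleteSpace G] [RKHS ℝ G (S × A) ℝ] {M : MDP S A} {ν : Measure S}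

theorem exists_nextExp_eq_integral_inner (hd : HasBoundedDensity G ν M.P) :
    ∃ f : S → G, (∀ s', ‖f s'‖ ≤ 1) ∧
      (∀ x, Measurable fun s' => inner ℝ (feature G x) (f s')) ∧
      ∀ W x, M.nextExp W x = ∫ s', inner ℝ (feature G x) (f s') * W s' ∂ν := by
  obtain ⟨p, hp0, hpm, hP, hf⟩ := hd
  choose f hfp hf1 using hf
  refine ⟨f, hf1, fun x => by simpa only [inner_feature, hfp] using hpm x, fun W x => ?_⟩
  rw [MDP.nextExp, hP, integral_withDensity_eq_integral_toReal_smul (hpm x).ennreal_ofReal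
    (.of_forall fun _ => ENNReal.ofReal_lt_top)]
  simp only [ENNReal.toReal_ofReal (hp0 _ x), smul_eq_mul, inner_feature, hfp]

variable [IsFiniteMeasure ν] (hd : HasBoundedDensity G ν M.P)
include hd

/-- The expected next value behaves like a function of norm at most `ν(S) b` in the RKHS. -/
theorem abs_nextExp_sub_le {W : S → ℝ} (hW : Measurable W) {b : ℝ} (hb : ∀ s, |W s| ≤ b) {J : ℕ}
    (z : Fin J → S × A) (w : Fin J → ℝ) (x : S × A) :
    |M.nextExp W x - ∑ i, w i * M.nextExp W (z i)| ≤
      ν.real Set.univ * b * ‖feature G x - ∑ i, w i • feature G (z i)‖ := by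
  obtain ⟨f, hf1, hfm, hf⟩ := hd.exists_nextExp_eq_integral_inner
  have hle (ξ : G) (s' : S) : ‖inner ℝ ξ (f s') * W s'‖ ≤ ‖ξ‖ * b := by
    rw [norm_mul]
    exact mul_le_mul ((norm_inner_le_norm _ _).trans
      (mul_le_of_le_one_right (norm_nonneg _) (hf1 s'))) (hb s') (norm_nonneg _) (norm_nonneg _)
  have hinteg (y : S × A) : Integrable (fun s' => inner ℝ (feature G y) (f s') * W s') ν :=
    .of_bound ((hfm y).mul hW).aestronglyMeasurable _ (.of_forall (hle _))
  have hcomb : M.nextExp W x - ∑ i, w i * M.nextExp W (z i) =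
      ∫ s', inner ℝ (feature G x - ∑ i, w i • feature G (z i)) (f s') * W s' ∂ν := by
    simp only [hf, inner_sub_left, sum_inner, sub_mul, Finset.sum_mul, real_inner_smul_left,
      mul_assoc, ← integral_const_mul]
    rw [integral_sub (hinteg x) (integrable_finsetSum _ fun i _ => (hinteg (z i)).const_mul _),
      integral_finsetSum _ fun i _ => (hinteg (z i)).const_mul _]
  rw [hcomb, ← Real.norm_eq_abs]
  refine (norm_integral_le_of_norm_le_const (.of_forall (hle _))).trans_eq ?_
  ring

theorem one_le_mul_norm (x : S × A) : 1 ≤ ν.real Set.univ * ‖feature G x‖ := by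
  simpa [MDP.nextExp] using hd.abs_nextExp_sub_le (W := fun _ => 1) measurable_const (b := 1)
    (by simp) (Fin.elim0 : Fin 0 → S × A) Fin.elim0 x

theorem isActionContinuous [TopologicalSpace A] (hr : ∀ s, Continuous fun a => M.r (s, a))
    (hφ : ∀ s, Continuous fun a => feature G (s, a)) : M.IsActionContinuous where
  continuous_r := hr
  continuous_nextExp {W} hW {b} hb s := by
    refine continuous_iff_continuousAt.2 fun a => ?_
    rw [ContinuousAt, tendsto_iff_norm_sub_tendsto_zero]
    have hmod : Continuous fun a' => ν.real Set.univ * b *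
        ‖feature G (s, a') - feature G (s, a)‖ :=
      (((hφ s).sub continuous_const).norm).const_mul _
    refine squeeze_zero (fun _ => norm_nonneg _) (fun a' => ?_)
      ((hmod.tendsto a).trans_eq (by simp))
    simpa using hd.abs_nextExp_sub_le hW hb (fun _ : Fin 1 => (s, a)) (fun _ => 1) (s, a')

end HasBoundedDensity

/-! ### Concentration -/

section Concentration

theorem measure_abs_sum_ge_le_of_iIndepFun {Ω ι : Type*} [MeasurableSpace Ω] {μ : Measure Ω}
    [Fintype ι] {X : ι → Ω → ℝ} (hind : iIndepFun X μ) {c : ι → NNReal}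
    (hX : ∀ i, HasSubgaussianMGF (X i) (c i) μ) {ε : ℝ} (hε : 0 ≤ ε) :
    μ.real {ω | ε ≤ |∑ i, X i ω|} ≤
      2 * Real.exp (-ε ^ 2 / (2 * ((∑ i, c i : NNReal) : ℝ))) := by
  have hneg : iIndepFun (fun i => -X i) μ := hind.comp (fun _ y => -y) fun _ => measurable_neg
  have hupper := HasSubgaussianMGF.measure_sum_ge_le_of_iIndepFun hind (s := Finset.univ)
    (fun i _ => hX i) hε
  have hlower := HasSubgaussianMGF.measure_sum_ge_le_of_iIndepFun hneg (s := Finset.univ)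
    (fun i _ => (hX i).neg) hε
  have hunion : {ω | ε ≤ |∑ i, X i ω|} =
      {ω | ε ≤ ∑ i, X i ω} ∪ {ω | ε ≤ ∑ i, (-X i) ω} := by
    ext ω
    simp [le_abs]
  rw [hunion, two_mul]
  exact (measureReal_union_le _ _).trans (add_le_add hupper hlower)

theorem hasSubgaussianMGF_pi_eval {Ω ι : Type*} [MeasurableSpace Ω] [Fintype ι]
    (P : ι → Measure Ω) [∀ i, IsProbabilityMeasure (P i)] {i : ι} {X : Ω → ℝ} {c : NNReal}
    (hX : HasSubgaussianMGF X c (P i)) :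
    HasSubgaussianMGF (fun x : ι → Ω => X (x i)) c (Measure.pi P) := by
  rw [← (measurePreserving_eval P i).map_eq] at hX
  exact .of_map (measurable_pi_apply i).aemeasurable hX

theorem measure_pi_weighted_sum_le {S : Type*} [MeasurableSpace S] {J : ℕ} (P : Fin J → Measure S)
    [∀ j, IsProbabilityMeasure (P j)] {G : S → ℝ} (hG : Measurable G) {b : ℝ}
    (hG0 : ∀ s, 0 ≤ G s) (hGb : ∀ s, G s ≤ b) (hb : 0 < b) (v : Fin J → ℝ) {σ a : ℝ} (hσ : 0 ≤ σ)
    (hv : ∑ j, v j * v j ≤ σ ^ 2) (ha : 0 ≤ a) :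
    Measure.pi P {x | σ * b * √(a / 2) < |∑ j, v j * (G (x j) - ∫ s, G s ∂(P j))|} ≤
      ENNReal.ofReal (2 * Real.exp (-a)) := by
  rcases (Finset.sum_nonneg fun j _ => mul_self_nonneg (v j)).eq_or_lt with hv0 | hvpos
  · have hvz (j : Fin J) : v j = 0 := mul_self_eq_zero.1 <|
      (Finset.sum_eq_zero_iff_of_nonneg fun j _ => mul_self_nonneg (v j)).1 hv0.symm j
        (Finset.mem_univ j)
    have hthr : 0 ≤ σ * b * √(a / 2) := by positivity
    simp only [hvz, zero_mul, Finset.sum_const_zero, abs_zero, hthr.not_gt, Set.ofPred_false,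
      measure_empty, zero_le]
  let c (j : Fin J) : NNReal := ⟨v j ^ 2, sq_nonneg _⟩ * (‖b - 0‖₊ / 2) ^ 2
  have hsub (j : Fin J) : HasSubgaussianMGF
      (fun x : Fin J → S => v j * (G (x j) - ∫ s, G s ∂(P j))) (c j) (Measure.pi P) :=
    hasSubgaussianMGF_pi_eval P ((hasSubgaussianMGF_of_mem_Icc hG.aemeasurable
      (.of_forall fun s => ⟨hG0 s, hGb s⟩)).const_mul (v j))
  have hind : iIndepFun (fun j (x : Fin J → S) => v j * (G (x j) - ∫ s, G s ∂(P j)))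
      (Measure.pi P) :=
    iIndepFun_pi (X := fun j s => v j * (G s - ∫ s, G s ∂(P j)))
      fun j => ((hG.sub_const _).const_mul _).aemeasurable
  have hc : ((∑ j, c j : NNReal) : ℝ) = (∑ j, v j * v j) * (b ^ 2 / 4) := by
    rw [NNReal.coe_sum, Finset.sum_mul]
    refine Finset.sum_congr rfl fun j _ => ?_
    change v j ^ 2 * (‖b - 0‖ / 2) ^ 2 = _
    rw [sub_zero, Real.norm_of_nonneg hb.le]
    ring
  have hexp : Real.exp (-(σ * b * √(a / 2)) ^ 2 / (2 * ((∑ j, c j : NNReal) : ℝ))) ≤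
      Real.exp (-a) := by
    rw [Real.exp_le_exp, hc, mul_pow, Real.sq_sqrt (by positivity), neg_div, neg_le_neg_iff,
      le_div_iff₀ (by positivity)]
    calc a * (2 * ((∑ j, v j * v j) * (b ^ 2 / 4))) = a * b ^ 2 / 2 * ∑ j, v j * v j := by ring
      _ ≤ a * b ^ 2 / 2 * σ ^ 2 := by gcongr
      _ = (σ * b) ^ 2 * (a / 2) := by ring
  refine (measure_mono (Set.ofPred_subset_ofPred.2 fun _ => le_of_lt)).trans ?_
  rw [← ofReal_measureReal]
  refine ENNReal.ofReal_le_ofReal ?_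
  exact (measure_abs_sum_ge_le_of_iIndepFun hind hsub (by positivity)).trans
    (mul_le_mul_of_nonneg_left hexp zero_le_two)

theorem measure_pi_le_of_section_le {ι Ω : Type*} [Fintype ι] [DecidableEq ι] [MeasurableSpace Ω]
    (μ : ι → Measure Ω) [∀ i, IsProbabilityMeasure (μ i)] (i : ι) {B : Set (ι → Ω)}
    (hB : MeasurableSet B) {δ : ENNReal}
    (h : ∀ ω, μ i {x | Function.update ω i x ∈ B} ≤ δ) : Measure.pi μ B ≤ δ := by
  have hmarginal := lintegral_le_of_lmarginal_le (μ := μ) {i} (f := B.indicator 1)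
    (g := fun _ => δ) (measurable_one.indicator hB) measurable_const ?_
  · simpa [lintegral_indicator_one hB] using hmarginal
  · intro ω
    rw [lmarginal_singleton, lmarginal_singleton]
    refine (lintegral_indicator_one (measurable_update ω hB)).trans_le ?_
    exact (h ω).trans_eq (by simp)

end Concentration

/-! ### The rounds of the algorithm -/

section Algorithm

variable {S A : Type*} [MeasurableSpace S] [MeasurableSpace A]

/-- Regularity of a kernel, in its first argument only, that makes the estimates of the algorithm
measurable, and continuous in the action. -/
structure IsActionContinuousKernel [TopologicalSpace A] (K : S × A → S × A → ℝ) : Prop where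
  measurable_left (y : S × A) : Measurable fun x => K x y
  continuous_left (y : S × A) (s : S) : Continuous fun a => K (s, a) y

theorem IsFeatureMap.isActionContinuousKernel [TopologicalSpace A] {E : Type*}
    [NormedAddCommGroup E] [InnerProductSpace ℝ E] {φ : S × A → E} {K : S × A → S × A → ℝ}
    (h : IsFeatureMap φ K) (hm : ∀ y, Measurable fun x => K x y)
    (hφ : ∀ s, Continuous fun a => φ (s, a)) : IsActionContinuousKernel K where
  measurable_left := hm
  continuous_left y s := by
    simpa only [h _ y] using (hφ s).inner (𝕜 := ℝ) (continuous_const (y := φ y))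

section Rounds

variable (M : MDP S A) (K : S × A → S × A → ℝ) (lam : ℝ) {J L : ℕ} (z : Fin J → S × A)
  (ω : Fin L → Fin J → S) (l : Fin L)

/-- The estimate of the continuation value that is sampled in round `l`. -/
noncomputable def roundValue : S → ℝ :=
  M.clippedValue (proxyQ M K lam z (observations M K lam z ω l l.2.le))

/-- The observations of round `l`, centered at their means given the earlier rounds. -/
noncomputable def roundNoise (j : Fin J) : ℝ :=
  roundValue M K lam z ω l (ω l j) - M.nextExp (roundValue M K lam z ω l) (z j)

/-- The error that round `l` makes in estimating the backup of the value it samples. -/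
noncomputable def bellmanError (x : S × A) : ℝ :=
  proxyQ M K lam z (observations M K lam z ω (l + 1) l.2) x -
    M.backup (roundValue M K lam z ω l) x

theorem observations_succ (j : Fin J) :
    observations M K lam z ω (l + 1) l.2 j = roundValue M K lam z ω l (ω l j) := rfl

theorem observations_congr {ω' : Fin L → Fin J → S} :
    ∀ (l : ℕ) (h : l ≤ L), (∀ i : Fin L, (i : ℕ) < l → ω i = ω' i) →
      observations M K lam z ω l h = observations M K lam z ω' l h
  | 0, _, _ => rfl
  | l + 1, h, hω => by
    funext j
    rw [observations_succ _ _ _ _ _ ⟨l, h⟩, observations_succ _ _ _ _ _ ⟨l, h⟩, roundValue,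
      roundValue, observations_congr l _ fun i hi => hω i (hi.trans l.lt_succ_self),
      hω ⟨l, h⟩ l.lt_succ_self]

theorem roundValue_update (x : Fin J → S) :
    roundValue M K lam z (Function.update ω l x) l = roundValue M K lam z ω l := by
  rw [roundValue, roundValue, observations_congr M K lam z _ l l.2.le fun i hi =>
    Function.update_of_ne (Fin.ne_of_lt hi) x ω]

theorem abs_roundNoise_le (j : Fin J) : |roundNoise M K lam z ω l j| ≤ 1 / (1 - M.γ) := by
  have hnext : 0 ≤ M.nextExp (roundValue M K lam z ω l) (z j) :=
    integral_nonneg fun _ => M.clip_nonneg _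
  have hnext' := (abs_le.1 (M.abs_nextExp_le (W := roundValue M K lam z ω l)
    (M.abs_clippedValue_le _) (z j))).2
  have hobs : 0 ≤ roundValue M K lam z ω l (ω l j) := M.clip_nonneg _
  have hobs' : roundValue M K lam z ω l (ω l j) ≤ 1 / (1 - M.γ) := M.clip_le _
  rw [roundNoise, abs_le]
  constructor <;> linarith

theorem roundNoise_dotProduct_self_le :
    roundNoise M K lam z ω l ⬝ᵥ roundNoise M K lam z ω l ≤ J * (1 / (1 - M.γ)) ^ 2 := by
  have hsq : ∀ j ∈ Finset.univ, roundNoise M K lam z ω l j * roundNoise M K lam z ω l j ≤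
      (1 / (1 - M.γ)) ^ 2 := fun j _ => by
    rw [← pow_two, ← sq_abs]
    exact pow_le_pow_left₀ (abs_nonneg _) (abs_roundNoise_le M K lam z ω l j) 2
  simpa [dotProduct] using Finset.sum_le_sum hsq

end Rounds

section Measurability

variable [TopologicalSpace A] {M : MDP S A} {K : S × A → S × A → ℝ} {J L : ℕ}
  (hK : IsActionContinuousKernel K) (lam : ℝ) (z : Fin J → S × A)
include hK

theorem IsActionContinuousKernel.measurable_proxyQ :
    Measurable fun p : (Fin J → ℝ) × (S × A) => proxyQ M K lam z p.1 p.2 := by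
  have hkrr : Measurable fun p : (Fin J → ℝ) × (S × A) => krr K lam z p.1 p.2 := by
    unfold krr kvec Matrix.mulVec dotProduct
    exact Finset.measurable_sum _ fun i _ => ((hK.measurable_left (z i)).comp measurable_snd).mul
      (Finset.measurable_sum _ fun j _ =>
        ((measurable_pi_apply j).comp measurable_fst).const_mul _)
  exact (M.measurable_r.comp measurable_snd).add (hkrr.const_mul _)

variable (hr : ∀ s, Continuous fun a => M.r (s, a))
include hr

theorem IsActionContinuousKernel.continuous_proxyQ (Y : Fin J → ℝ) (s : S) :
    Continuous fun a => proxyQ M K lam z Y (s, a) := by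
  unfold proxyQ krr kvec dotProduct
  exact (hr s).add (continuous_const.mul
    (continuous_finsetSum _ fun i _ => (hK.continuous_left (z i) s).mul continuous_const))

variable [TopologicalSpace.SeparableSpace A]

theorem IsActionContinuousKernel.measurable_clippedValue_proxyQ :
    Measurable fun p : (Fin J → ℝ) × S => M.clippedValue (proxyQ M K lam z p.1) p.2 :=
  M.measurable_clip.comp <| measurable_iSup_of_continuous
    (fun _ => (hK.measurable_proxyQ lam z).comp
      (measurable_fst.prodMk (measurable_snd.prodMk measurable_const)))
    fun p => hK.continuous_proxyQ lam z hr p.1 p.2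

theorem IsActionContinuousKernel.measurable_observations (l : ℕ) (h : l ≤ L) :
    Measurable fun ω : Fin L → Fin J → S => observations M K lam z ω l h := by
  induction l with
  | zero => exact measurable_const
  | succ l ih =>
    exact measurable_pi_lambda _ fun j => (hK.measurable_clippedValue_proxyQ lam z hr).comp
      ((ih (Nat.le_of_succ_le h)).prodMk
        ((measurable_pi_apply j).comp (measurable_pi_apply (⟨l, h⟩ : Fin L))))

theorem IsActionContinuousKernel.measurable_uncurry_roundValue (l : Fin L) :
    Measurable fun p : (Fin L → Fin J → S) × S => roundValue M K lam z p.1 l p.2 := by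
  have hobs : Measurable fun p : (Fin L → Fin J → S) × S =>
      (observations M K lam z p.1 l l.2.le, p.2) :=
    ((hK.measurable_observations lam z hr l l.2.le).comp measurable_fst).prodMk measurable_snd
  simpa only [Function.comp_def, roundValue] using
    (hK.measurable_clippedValue_proxyQ lam z hr).comp hobs

theorem IsActionContinuousKernel.measurable_roundValue (ω : Fin L → Fin J → S) (l : Fin L) :
    Measurable (roundValue M K lam z ω l) := by
  simpa only [Function.comp_def] using
    (hK.measurable_uncurry_roundValue lam z hr l).comp (measurable_prodMk_left (x := ω))

theorem IsActionContinuousKernel.measurable_roundNoise (l : Fin L) (j : Fin J) :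
    Measurable fun ω : Fin L → Fin J → S => roundNoise M K lam z ω l j := by
  have hvalue := hK.measurable_uncurry_roundValue lam z hr l
  exact (hvalue.comp (measurable_id.prodMk
      ((measurable_pi_apply j).comp (measurable_pi_apply l)))).sub
    (hvalue.stronglyMeasurable.integral_prod_right' (ν := M.P (z j))).measurable

theorem IsActionContinuousKernel.measurableSet_lt_abs_sum_roundNoise (l : Fin L) (v : Fin J → ℝ)
    (t : ℝ) : MeasurableSet
      {ω : Fin L → Fin J → S | t < |∑ j, v j * roundNoise M K lam z ω l j|} :=
  measurableSet_lt measurable_const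
    (Finset.measurable_sum _ fun j _ => (hK.measurable_roundNoise lam z hr l j).const_mul _).abs

/-- The value sampled in round `l` depends on the earlier samples only, so conditionally on those
the noise is independent and centered. -/
theorem IsActionContinuousKernel.measure_roundNoise_le (l : Fin L) (v : Fin J → ℝ) {σ a : ℝ}
    (hσ : 0 ≤ σ) (hv : ∑ j, v j * v j ≤ σ ^ 2) (ha : 0 ≤ a) :
    sampleLaw M L z {ω | σ * (1 / (1 - M.γ)) * √(a / 2) <
      |∑ j, v j * roundNoise M K lam z ω l j|} ≤ ENNReal.ofReal (2 * Real.exp (-a)) := by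
  refine measure_pi_le_of_section_le _ l
    (hK.measurableSet_lt_abs_sum_roundNoise lam z hr l v _) fun ω => ?_
  simp only [roundNoise, roundValue_update, Set.mem_ofPred_eq, Function.update_self]
  exact measure_pi_weighted_sum_le (fun j => M.P (z j))
    (hK.measurable_roundValue lam z hr ω l)
    (fun s => M.clip_nonneg _) (fun s => M.clip_le _) (one_div_pos.2 M.one_sub_γ_pos) v hσ hv ha

end Measurability

end Algorithm

/-! ### Elementary inequalities -/

section Elementary

theorem mul_log_one_add_le {κ y : ℝ} (hκ0 : 0 ≤ κ) (hκ1 : κ ≤ 1) (hy : 0 ≤ y) :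
    κ * Real.log (1 + y) ≤ Real.log (1 + κ * y) := by
  rw [← Real.log_rpow (by positivity)]
  exact Real.log_le_log (by positivity)
    (rpow_one_add_le_one_add_mul_self (by linarith) hκ0 hκ1)

theorem log_one_add_sq_le {y : ℝ} (hy : 0 ≤ y) : Real.log (1 + y) ^ 2 ≤ 4 * y := by
  have hlog : Real.log (1 + y) ≤ 2 * √y :=
    calc Real.log (1 + y) ≤ Real.log ((1 + √y) ^ 2) := by
          refine Real.log_le_log (by positivity) ?_
          nlinarith [Real.sq_sqrt hy, Real.sqrt_nonneg y]
      _ = 2 * Real.log (1 + √y) := by rw [Real.log_pow, Nat.cast_ofNat]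
      _ ≤ 2 * √y := by linarith [Real.log_le_sub_one_of_pos (by positivity : 0 < 1 + √y)]
  calc Real.log (1 + y) ^ 2 ≤ (2 * √y) ^ 2 :=
        pow_le_pow_left₀ (Real.log_nonneg (by linarith)) hlog 2
    _ = 4 * y := by rw [mul_pow, Real.sq_sqrt hy]; norm_num

theorem div_one_add_le_log_one_add {x : ℝ} (hx : 0 ≤ x) : x / (1 + x) ≤ Real.log (1 + x) :=
  calc x / (1 + x) = 1 - (1 + x)⁻¹ := by
        field_simp
        ring
    _ ≤ Real.log (1 + x) := Real.one_sub_inv_le_log_of_pos (by positivity)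

theorem mul_log_div_mul_log_le {s y : ℝ} (hs0 : 0 ≤ s) (hs1 : s ≤ 1) (hy : 0 ≤ y) :
    s * Real.log ((1 + y) / (1 + s * y)) * Real.log (1 + y) ≤ 5 * Real.log (1 + s * y) := by
  have hsy : 0 ≤ s * y := mul_nonneg hs0 hy
  set ρ := (1 + y) / (1 + s * y) with hρ
  have hρ1 : 1 ≤ ρ := by
    rw [hρ, one_le_div (by positivity)]
    nlinarith
  have hsρ : s * (ρ - 1) ≤ s * y / (1 + s * y) :=
    calc s * (ρ - 1) = (1 - s) * (s * y / (1 + s * y)) := by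
          rw [hρ]
          field_simp
          ring
      _ ≤ s * y / (1 + s * y) := mul_le_of_le_one_left (by positivity) (by linarith)
  have hlin : s * Real.log ρ ≤ 1 :=
    calc s * Real.log ρ ≤ s * (ρ - 1) := by
          gcongr
          exact Real.log_le_sub_one_of_pos (by linarith)
      _ ≤ s * y / (1 + s * y) := hsρ
      _ ≤ 1 := div_le_one_of_le₀ (by linarith) (by positivity)
  have hquad : s * Real.log ρ ^ 2 ≤ 4 * Real.log (1 + s * y) :=
    calc s * Real.log ρ ^ 2 ≤ s * (4 * (ρ - 1)) := by
          gcongr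
          simpa using log_one_add_sq_le (sub_nonneg.2 hρ1)
      _ = 4 * (s * (ρ - 1)) := mul_left_comm _ _ _
      _ ≤ 4 * Real.log (1 + s * y) := by
          gcongr
          exact hsρ.trans (div_one_add_le_log_one_add hsy)
  have hlog : Real.log (1 + y) = Real.log ρ + Real.log (1 + s * y) := by
    rw [← Real.log_mul (by linarith) (by positivity), hρ, div_mul_cancel₀ _ (by positivity)]
  calc s * Real.log ρ * Real.log (1 + y)
      = s * Real.log ρ ^ 2 + s * Real.log ρ * Real.log (1 + s * y) := by rw [hlog]; ring
    _ ≤ 4 * Real.log (1 + s * y) + 1 * Real.log (1 + s * y) :=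
        add_le_add hquad (mul_le_mul_of_nonneg_right hlin (Real.log_nonneg (by linarith)))
    _ = 5 * Real.log (1 + s * y) := by ring

theorem sqrt_mul_one_add_le {a u : ℝ} (ha : 0 ≤ a) (hu : 0 ≤ u) :
    √(a * (1 + u)) ≤ √a * (1 + u) := by
  rw [Real.sqrt_mul ha]
  gcongr
  exact (Real.sqrt_le_left (by positivity)).2 (by nlinarith)

theorem sum_exp_neg_mul_le {x : ℝ} (hx : 0 < x) (L : ℕ) :
    ∑ l : Fin L, Real.exp (-(x * (L - l))) ≤ 1 / x := by
  induction L with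
  | zero => simp [hx.le]
  | succ L ih =>
    have hshift (l : Fin L) : Real.exp (-(x * ((L + 1 : ℕ) - l.castSucc))) =
        Real.exp (-x) * Real.exp (-(x * (L - l))) := by
      rw [← Real.exp_add, Fin.val_castSucc, Nat.cast_succ]
      ring_nf
    have hlast : Real.exp (-(x * ((L + 1 : ℕ) - Fin.last L))) = Real.exp (-x) := by
      rw [Fin.val_last, Nat.cast_succ, add_sub_cancel_left, mul_one]
    have hexp : Real.exp (-x) * (1 + x) ≤ 1 := by
      rw [Real.exp_neg, inv_mul_le_one₀ (Real.exp_pos x), add_comm]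
      exact Real.add_one_le_exp x
    rw [Fin.sum_univ_castSucc, Finset.sum_congr rfl fun l _ => hshift l, ← Finset.mul_sum, hlast]
    calc Real.exp (-x) * ∑ l : Fin L, Real.exp (-(x * (L - l))) + Real.exp (-x)
        ≤ Real.exp (-x) * (1 / x) + Real.exp (-x) := by gcongr
      _ = Real.exp (-x) * (1 + x) / x := by field_simp
      _ ≤ 1 / x := by gcongr

theorem sum_union_bound_le {N a η δ : ℝ} (hη : 0 < η) (hδ : 0 ≤ δ) (ha : 1 ≤ a)
    (haN : 2 * N ≤ η * δ * Real.exp a) (L : ℕ) :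
    ∑ l : Fin L, N * (2 * Real.exp (-(a * (1 + η * (L - l))))) ≤ δ := by
  have hsplit (l : Fin L) : N * (2 * Real.exp (-(a * (1 + η * (L - l))))) =
      2 * N * Real.exp (-a) * Real.exp (-(a * η * (L - l))) := by
    rw [show -(a * (1 + η * (L - l))) = -a + -(a * η * (L - l)) by ring, Real.exp_add]
    ring
  have hN : 2 * N * Real.exp (-a) ≤ η * δ := by
    rwa [Real.exp_neg, ← div_eq_mul_inv, div_le_iff₀ (Real.exp_pos _)]
  rw [Finset.sum_congr rfl fun l _ => hsplit l, ← Finset.mul_sum]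
  calc 2 * N * Real.exp (-a) * ∑ l : Fin L, Real.exp (-(a * η * (L - l)))
      ≤ η * δ * (1 / (a * η)) :=
        mul_le_mul hN (sum_exp_neg_mul_le (by positivity) L)
          (Finset.sum_nonneg fun _ _ => (Real.exp_pos _).le) (by positivity)
    _ = δ / a := by field_simp
    _ ≤ δ := div_le_self hδ ha

end Elementary

/-! ### The error of one round -/

/-- Covering numbers of order `d` at the scales `1 / n`, for the distance `‖φ x - φ y‖` that a
feature map induces. The constant is `cD`. -/
def HasPolynomialCovering {Z E : Type*} [NormedAddCommGroup E] (φ : Z → E) (cD : ℝ) (d : ℕ) :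
    Prop :=
  ∀ n : ℕ, 1 ≤ n → ∃ D : Finset Z, (D.card : ℝ) ≤ cD * (n : ℝ) ^ d ∧
    ∀ x, ∃ y ∈ D, ‖φ x - φ y‖ ≤ 1 / n

theorem norm_feature_sub_le_of_forall {Z H : Type*} [NormedAddCommGroup H]
    [InnerProductSpace ℝ H] [CompleteSpace H] [RKHS ℝ H Z ℝ] {x y : Z} {η : ℝ}
    (h : ∀ f : H, ‖f‖ ≤ 1 → f x - f y ≤ η) : ‖feature H x - feature H y‖ ≤ η := by
  set g := feature H x - feature H y with hg
  have hunit : ‖‖g‖⁻¹ • g‖ ≤ 1 := by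
    rw [norm_smul, norm_inv, norm_norm]
    exact inv_mul_le_one
  have heval : (‖g‖⁻¹ • g) x - (‖g‖⁻¹ • g) y = ‖g‖ := by
    rw [← inner_feature x, ← inner_feature y, ← inner_sub_left, ← hg, real_inner_smul_right,
      real_inner_self_eq_norm_sq, pow_two, ← mul_assoc]
    exact inv_mul_mul_self ‖g‖
  exact heval ▸ h _ hunit

theorem HasDiscretization.hasPolynomialCovering {m k : ℕ} {S : Set (EuclideanSpace ℝ (Fin m))}
    {A : Set (EuclideanSpace ℝ (Fin k))} {H : Type*} [NormedAddCommGroup H]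
    [InnerProductSpace ℝ H] [CompleteSpace H] [RKHS ℝ H (S × A) ℝ] {cD : ℝ}
    (h : HasDiscretization (S := S) (A := A) H cD) :
    HasPolynomialCovering (feature (Z := S × A) H) cD (m + k) := fun n hn => by
  obtain ⟨D, near, hcard, hnear, hD⟩ := h n 1 hn le_rfl
  rw [one_pow, mul_one] at hcard
  exact ⟨D, hcard, fun x => ⟨near x, (hnear x).1,
    norm_feature_sub_le_of_forall fun f hf => hD f hf x⟩⟩

theorem IsFeatureMap.abs_krr_sub_krr_le {Z E : Type*} [NormedAddCommGroup E]
    [InnerProductSpace ℝ E] {φ : Z → E} {K : Z → Z → ℝ} (hφ : IsFeatureMap φ K) {lam : ℝ}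
    (hlam : 0 < lam) {J : ℕ} (z : Fin J → Z) (ε : Fin J → ℝ) (x y : Z) :
    |krr K lam z ε x - krr K lam z ε y| ≤ ‖φ x - φ y‖ * (√(ε ⬝ᵥ ε) / lam) := by
  rw [hφ.krr_eq_inner, hφ.krr_eq_inner, ← inner_sub_left]
  refine (abs_real_inner_le_norm _ _).trans ?_
  gcongr
  rw [le_div_iff₀' hlam]
  refine Real.le_sqrt_of_sq_le ?_
  rw [mul_pow]
  exact hφ.norm_interpolant_sq_le hlam z ε

section RoundError

variable {S A : Type*} [MeasurableSpace S] [MeasurableSpace A] {M : MDP S A}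
  {K : S × A → S × A → ℝ} {lam : ℝ} {J L : ℕ} {z : Fin J → S × A} {ω : Fin L → Fin J → S}
  {l : Fin L}

section FeatureMap

variable {E : Type*} [NormedAddCommGroup E] [InnerProductSpace ℝ E] {φ : S × A → E}
  (hφ : IsFeatureMap φ K)
include hφ

/-- Bias-variance decomposition. -/
theorem IsFeatureMap.bellmanError_eq (x : S × A) :
    bellmanError M K lam z ω l x = M.γ * (krr K lam z (roundNoise M K lam z ω l) x -
      (M.nextExp (roundValue M K lam z ω l) x -
        ∑ j, ridgeWeights K lam z x j * M.nextExp (roundValue M K lam z ω l) (z j))) := by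
  rw [bellmanError, proxyQ, MDP.backup, hφ.krr_eq_dotProduct_ridgeWeights,
    hφ.krr_eq_dotProduct_ridgeWeights]
  simp only [dotProduct, observations_succ, roundNoise, mul_sub, Finset.sum_sub_distrib]
  ring

theorem IsFeatureMap.abs_krr_roundNoise_le_add (hlam : 0 < lam) (x y : S × A) :
    |krr K lam z (roundNoise M K lam z ω l) x| ≤
      |krr K lam z (roundNoise M K lam z ω l) y| +
        √J / (lam * (1 - M.γ)) * ‖φ x - φ y‖ := by
  have hγ := M.one_sub_γ_pos
  have hnoise : √(roundNoise M K lam z ω l ⬝ᵥ roundNoise M K lam z ω l) ≤ √J * (1 / (1 - M.γ)) := by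
    refine (Real.sqrt_le_sqrt (roundNoise_dotProduct_self_le M K lam z ω l)).trans_eq ?_
    rw [Real.sqrt_mul (Nat.cast_nonneg J), Real.sqrt_sq (by positivity)]
  rw [← sub_le_iff_le_add']
  calc _ ≤ _ := abs_sub_abs_le_abs_sub _ _
    _ ≤ ‖φ x - φ y‖ * (√J * (1 / (1 - M.γ)) / lam) :=
        (hφ.abs_krr_sub_krr_le hlam z _ x y).trans (by gcongr)
    _ = √J / (lam * (1 - M.γ)) * ‖φ x - φ y‖ := by field_simp

end FeatureMap

variable {H : Type*} [NormedAddCommGroup H] [InnerProductSpace ℝ H] [CompleteSpace H]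
  [RKHS ℝ H (S × A) ℝ] (hφ : IsFeatureMap (feature H) K)
include hφ

theorem IsFeatureMap.abs_bellmanError_le (hlam : 0 < lam) {ν : Measure S} [IsFiniteMeasure ν]
    (hd : HasBoundedDensity H ν M.P) (hW : Measurable (roundValue M K lam z ω l)) {x : S × A}
    {u : ℝ} (hu : 0 ≤ u) (hux : uncertaintySq K lam z x ≤ u ^ 2) :
    |bellmanError M K lam z ω l x| ≤ M.γ * (ν.real Set.univ * (1 / (1 - M.γ)) * u +
      |krr K lam z (roundNoise M K lam z ω l) x|) := by
  have hγ := M.one_sub_γ_pos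
  have hridge : ‖feature H x - ∑ i, ridgeWeights K lam z x i • feature H (z i)‖ ≤ u :=
    le_of_sq_le_sq ((hφ.norm_sub_ridge_sq_le hlam z x).trans hux) hu
  rw [hφ.bellmanError_eq, abs_mul, abs_of_pos M.γ_pos]
  refine mul_le_mul_of_nonneg_left ?_ M.γ_pos.le
  refine (abs_sub _ _).trans ?_
  rw [add_comm]
  gcongr
  exact (hd.abs_nextExp_sub_le hW (M.abs_clippedValue_le _) z _ x).trans (by gcongr)

end RoundError

/-! ### The errors of all rounds -/

/-- With probability at least `1 - δ`, the errors of all rounds are at most `γ` times a common bias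
`b` plus a noise level `t`, where `b + 2 t ≤ w`. The noise level of a round may grow linearly with
the number of rounds that follow it: their discounting compensates for the growth, and the
accumulated error is at most `γ w / (1 - γ)`. -/
def HasErrorWidth {S A : Type*} [MeasurableSpace S] [MeasurableSpace A] (M : MDP S A)
    (K : S × A → S × A → ℝ) (lam : ℝ) (L : ℕ) {J : ℕ} (z : Fin J → S × A) (δ w : ℝ) : Prop :=
  ∃ (E : Set (Fin L → Fin J → S)) (b t : ℝ), MeasurableSet E ∧
    ENNReal.ofReal (1 - δ) ≤ sampleLaw M L z E ∧ 0 ≤ b ∧ 0 ≤ t ∧ b + 2 * t ≤ w ∧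
    ∀ ω ∈ E, ∀ l x, |bellmanError M K lam z ω l x| ≤
      M.γ * (b + t * (1 + (1 - M.γ) * (L - l)))

theorem exists_measurableSet_forall_notMem {Ω ι : Type*} [MeasurableSpace Ω] {μ : Measure Ω}
    [IsProbabilityMeasure μ] (s : Finset ι) {bad : ι → Set Ω}
    (hbad : ∀ i, MeasurableSet (bad i)) {p : ι → ℝ} (hp : ∀ i, 0 ≤ p i)
    (hμ : ∀ i, μ (bad i) ≤ ENNReal.ofReal (p i)) {δ : ℝ} (hδ : 0 ≤ δ) (hsum : ∑ i ∈ s, p i ≤ δ) :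
    ∃ E, MeasurableSet E ∧ ENNReal.ofReal (1 - δ) ≤ μ E ∧ ∀ ω ∈ E, ∀ i ∈ s, ω ∉ bad i := by
  have hmeas : MeasurableSet (⋃ i ∈ s, bad i) := s.measurableSet_biUnion fun i _ => hbad i
  have hunion : μ (⋃ i ∈ s, bad i) ≤ ENNReal.ofReal δ :=
    calc μ (⋃ i ∈ s, bad i) ≤ ∑ i ∈ s, ENNReal.ofReal (p i) :=
          (measure_biUnion_finset_le s bad).trans (Finset.sum_le_sum fun i _ => hμ i)
      _ ≤ ENNReal.ofReal δ := by
          rw [← ENNReal.ofReal_sum_of_nonneg fun i _ => hp i]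
          exact ENNReal.ofReal_le_ofReal hsum
  refine ⟨(⋃ i ∈ s, bad i)ᶜ, hmeas.compl, ?_, fun ω hω i hi h =>
    hω (Set.mem_iUnion₂.2 ⟨i, hi, h⟩)⟩
  rw [prob_compl_eq_one_sub hmeas, ENNReal.ofReal_sub _ hδ, ENNReal.ofReal_one]
  exact tsub_le_tsub_left hunion _

section Rounds

variable {S A : Type*} [MeasurableSpace S] [MeasurableSpace A] {M : MDP S A}
  {K : S × A → S × A → ℝ} {lam : ℝ} {J L : ℕ} {z : Fin J → S × A}

instance : IsProbabilityMeasure (sampleLaw M L z) := by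
  unfold sampleLaw; infer_instance

theorem HasErrorWidth.mono {δ w w' : ℝ} (h : HasErrorWidth M K lam L z δ w) (hw : w ≤ w') :
    HasErrorWidth M K lam L z δ w' := by
  obtain ⟨E, b, t, hE, hprob, hb, ht, hbt, herr⟩ := h
  exact ⟨E, b, t, hE, hprob, hb, ht, hbt.trans hw, herr⟩

theorem HasErrorWidth.of_forall {δ w : ℝ} (hδ : 0 ≤ δ) (hw : 0 ≤ w)
    (h : ∀ (ω : Fin L → Fin J → S) l x, |bellmanError M K lam z ω l x| ≤ M.γ * w) :
    HasErrorWidth M K lam L z δ w := by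
  refine ⟨Set.univ, w, 0, .univ, ?_, hw, le_rfl, by simp, fun ω _ l x => ?_⟩
  · rw [measure_univ]
    exact ENNReal.ofReal_le_one.2 (sub_le_self 1 hδ)
  · simpa using h ω l x

/-- The noise of round `l` is allowed to be larger by the factor `1 + (1 - γ) (L - l)`, which makes
the union bound over the rounds cost a factor of order `1 / (1 - γ)` instead of `L`. -/
theorem IsActionContinuousKernel.exists_forall_abs_krr_roundNoise_le [TopologicalSpace A]
    [TopologicalSpace.SeparableSpace A] (hK : IsActionContinuousKernel K)
    (hr : ∀ s, Continuous fun a => M.r (s, a)) {E : Type*} [NormedAddCommGroup E]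
    [InnerProductSpace ℝ E] {φ : S × A → E} (hφ : IsFeatureMap φ K) (hlam : 0 < lam)
    (D : Finset (S × A)) {u : ℝ} (hu : 0 ≤ u) (hux : ∀ x, uncertaintySq K lam z x ≤ u ^ 2)
    {δ a : ℝ} (hδ : 0 ≤ δ) (ha : 1 ≤ a) (hD : 2 * D.card ≤ (1 - M.γ) * δ * Real.exp a) :
    ∃ E : Set (Fin L → Fin J → S), MeasurableSet E ∧
      ENNReal.ofReal (1 - δ) ≤ sampleLaw M L z E ∧
      ∀ ω ∈ E, ∀ (l : Fin L), ∀ y ∈ D, |krr K lam z (roundNoise M K lam z ω l) y| ≤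
        u / lam * (1 / (1 - M.γ)) * √(a / 2) * (1 + (1 - M.γ) * (L - l)) := by
  have hγ := M.one_sub_γ_pos
  have hfactor (l : Fin L) : 0 ≤ (1 - M.γ) * (L - l : ℝ) :=
    mul_nonneg hγ.le (sub_nonneg.2 (Nat.cast_le.2 l.2.le))
  have hexponent (l : Fin L) : 0 ≤ a * (1 + (1 - M.γ) * (L - l)) :=
    mul_nonneg (by linarith) (by linarith [hfactor l])
  let bad (i : Fin L × (S × A)) : Set (Fin L → Fin J → S) :=
    {ω | u / lam * (1 / (1 - M.γ)) * √(a * (1 + (1 - M.γ) * (L - i.1)) / 2) <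
      |∑ j, ridgeWeights K lam z i.2 j * roundNoise M K lam z ω i.1 j|}
  have hbad (i : Fin L × (S × A)) : sampleLaw M L z (bad i) ≤
      ENNReal.ofReal (2 * Real.exp (-(a * (1 + (1 - M.γ) * (L - i.1))))) := by
    refine hK.measure_roundNoise_le lam z hr i.1 _ (by positivity) ?_ (hexponent i.1)
    rw [div_pow, le_div_iff₀' (by positivity)]
    exact (hφ.ridgeWeights_sq_le hlam z i.2).trans (hux i.2)
  obtain ⟨E, hE, hprob, hgood⟩ := exists_measurableSet_forall_notMem (Finset.univ ×ˢ D)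
    (fun i => hK.measurableSet_lt_abs_sum_roundNoise lam z hr i.1 _ _) (fun i => by positivity)
    hbad hδ (by
      rw [Finset.sum_product]
      simpa only [Finset.sum_const, nsmul_eq_mul] using sum_union_bound_le hγ hδ ha hD L)
  refine ⟨E, hE, hprob, fun ω hω l y hy => ?_⟩
  rw [hφ.krr_eq_dotProduct_ridgeWeights]
  refine (not_lt.1 (hgood ω hω (l, y) (by simpa using hy))).trans ?_
  rw [mul_div_right_comm, mul_assoc _ √(a / 2)]
  gcongr
  exact sqrt_mul_one_add_le (by positivity) (hfactor l)

section Net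

variable {H : Type*} [NormedAddCommGroup H] [InnerProductSpace ℝ H] [CompleteSpace H]
  [RKHS ℝ H (S × A) ℝ] [TopologicalSpace A] [TopologicalSpace.SeparableSpace A]

theorem IsFeatureMap.hasErrorWidth_of_net (hφ : IsFeatureMap (feature H) K)
    (hK : IsActionContinuousKernel K) (hr : ∀ s, Continuous fun a => M.r (s, a))
    (hlam : 0 < lam) {ν : Measure S} [IsFiniteMeasure ν] (hdens : HasBoundedDensity H ν M.P)
    {D : Finset (S × A)} {η : ℝ} (hη : 0 ≤ η)
    (hnet : ∀ x, ∃ y ∈ D, ‖feature H x - feature H y‖ ≤ η) {u : ℝ} (hu : 0 ≤ u)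
    (hux : ∀ x, uncertaintySq K lam z x ≤ u ^ 2) {δ a : ℝ} (hδ : 0 ≤ δ) (ha : 1 ≤ a)
    (hD : 2 * D.card ≤ (1 - M.γ) * δ * Real.exp a) :
    HasErrorWidth M K lam L z δ (ν.real Set.univ * (1 / (1 - M.γ)) * u +
      √J / (lam * (1 - M.γ)) * η + 2 * (u / lam * (1 / (1 - M.γ)) * √(a / 2))) := by
  have hγ := M.one_sub_γ_pos
  obtain ⟨E, hE, hprob, hnoise⟩ :=
    hK.exists_forall_abs_krr_roundNoise_le hr hφ hlam D hu hux hδ ha hD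
  refine ⟨E, _, _, hE, hprob, by positivity, by positivity, le_rfl, fun ω hω l x => ?_⟩
  obtain ⟨y, hy, hxy⟩ := hnet x
  refine (hφ.abs_bellmanError_le hlam hdens (hK.measurable_roundValue lam z hr ω l) hu
    (hux x)).trans (mul_le_mul_of_nonneg_left ?_ M.γ_pos.le)
  rw [add_assoc]
  gcongr
  calc _ ≤ _ := hφ.abs_krr_roundNoise_le_add hlam x y
    _ ≤ _ := add_le_add (hnoise ω hω l y hy) (mul_le_mul_of_nonneg_left hxy (by positivity))
    _ = _ := add_comm _ _

end Net

section Propagation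

variable [TopologicalSpace A] [CompactSpace A] [TopologicalSpace.SeparableSpace A] [Nonempty A]

/-- The bound on the accumulated error solves the recursion exactly. -/
theorem MDP.IsActionContinuous.abs_proxyQ_sub_backup_valueIter_le (hM : M.IsActionContinuous)
    (hK : IsActionContinuousKernel K) {ω : Fin L → Fin J → S} {b t : ℝ} (hb : 0 ≤ b)
    (ht : 0 ≤ t)
    (herr : ∀ l x, |bellmanError M K lam z ω l x| ≤
      M.γ * (b + t * (1 + (1 - M.γ) * (L - l)))) (l : ℕ) (hl : l ≤ L) (x : S × A) :
    |proxyQ M K lam z (observations M K lam z ω l hl) x - M.backup (M.valueIter l) x| ≤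
      M.γ * ((b + 2 * t) / (1 - M.γ) + t * (L - l)) := by
  have hγ := M.one_sub_γ_pos
  induction l generalizing x with
  | zero =>
    have hzero : proxyQ M K lam z (observations M K lam z ω 0 hl) x = M.r x := by
      simp [proxyQ, observations, krr]
    have := M.γ_pos.le
    rw [hzero, MDP.valueIter, MDP.backup_zero, sub_self, abs_zero, Nat.cast_zero, sub_zero]
    positivity
  | succ l ih =>
    have hrec := hM.abs_sub_backup_valueIter_succ_le l
      ((hK.measurable_proxyQ lam z).comp measurable_prodMk_left)
      (hK.continuous_proxyQ lam z hM.continuous_r _) (ih (Nat.le_of_succ_le hl))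
      (herr ⟨l, hl⟩) x
    refine hrec.trans_eq ?_
    push_cast
    field_simp
    ring

theorem HasErrorWidth.exists_forall_abs_value_sub_optValue_le {δ w : ℝ}
    (h : HasErrorWidth M K lam L z δ w) (hM : M.IsActionContinuous)
    (hK : IsActionContinuousKernel K) :
    ∃ E : Set (Fin L → Fin J → S), MeasurableSet E ∧
      ENNReal.ofReal (1 - δ) ≤ sampleLaw M L z E ∧
      ∀ ω ∈ E, ∀ π : Policy S A, IsGreedy π (outputQ M K lam z ω) →
        ∀ s, |M.value π s - M.optValue s| ≤
          2 * w * (M.γ / (1 - M.γ) ^ 2) + M.γ ^ L / (1 - M.γ) := by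
  have hγ := M.one_sub_γ_pos
  have hγ' := M.γ_pos
  obtain ⟨E, b, t, hE, hprob, hb, ht, hbt, herr⟩ := h
  refine ⟨E, hE, hprob, fun ω hω π hπ s => ?_⟩
  have hoe (x : S × A) : |outputQ M K lam z ω x - M.backup (M.valueIter L) x| ≤
      M.γ * (w / (1 - M.γ)) := by
    refine (hM.abs_proxyQ_sub_backup_valueIter_le hK hb ht (herr ω hω) L le_rfl x).trans ?_
    rw [sub_self, mul_zero, add_zero]
    gcongr
  refine (hM.abs_value_sub_optValue_le L hπ hoe s).trans_eq ?_
  field_simp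

end Propagation

end Rounds

/-! ### The size of the errors -/

section ErrorSize

/-- The order `√(2 Γ / (log (1 + λ⁻²) J))` of the uncertainty of a maximum uncertainty design of
`J` points with information gain `Γ`. -/
noncomputable def uncertaintyBound (lam : ℝ) (J : ℕ) (Γ : ℝ) : ℝ :=
  √(2 * Γ / (Real.log (1 + 1 / lam ^ 2) * J))

/-- The resolution at which the features are discretized when the uncertainty is at most `u`,
up to a factor `1 / J`. It is the ratio of the regularized standard deviations after and before
the observations. -/
noncomputable def netResolution (lam u : ℝ) : ℝ := √((u ^ 2 + lam ^ 2) / (1 + lam ^ 2))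

/-- The factor of `d log (J / ((1 - γ) δ))` in the exponent of the union bound over the net. -/
noncomputable def netConst (cD : ℝ) : ℝ := 2 + 2 * Real.log (1 + 2 * cD)

/-- The constant in front of the order of the confidence width. -/
noncomputable def widthConst (cD : ℝ) : ℝ := 4 + 4 * √((netConst cD + 5) / 2)

variable {cD lam u Γ : ℝ} {J d : ℕ}

theorem two_le_netConst (hcD : 0 < cD) : 2 ≤ netConst cD := by
  have : 0 ≤ Real.log (1 + 2 * cD) := Real.log_nonneg (by linarith)
  unfold netConst
  linarith

theorem four_le_widthConst (cD : ℝ) : 4 ≤ widthConst cD := by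
  unfold widthConst
  linarith [Real.sqrt_nonneg ((netConst cD + 5) / 2)]

section UncertaintyBound

theorem uncertaintyBound_nonneg : 0 ≤ uncertaintyBound lam J Γ := Real.sqrt_nonneg _

theorem log_one_add_inv_sq_pos (hlam : 0 < lam) : 0 < Real.log (1 + 1 / lam ^ 2) :=
  Real.log_pos (lt_add_of_pos_right _ (by positivity))

variable (hlam : 0 < lam) (hJ : 1 ≤ J)
include hlam hJ

theorem le_log_mul_uncertaintyBound_sq {q : ℝ} (h : J * q ≤ 2 * Γ) :
    q ≤ Real.log (1 + 1 / lam ^ 2) * uncertaintyBound lam J Γ ^ 2 := by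
  have hlog := log_one_add_inv_sq_pos hlam
  rw [← div_le_iff₀' hlog, uncertaintyBound, Real.sq_sqrt']
  refine le_max_of_le_left ?_
  rwa [div_le_div_iff₀ hlog (mul_pos hlog (Nat.cast_pos.2 hJ)), mul_comm _ (J : ℝ), ← mul_assoc,
    mul_comm q, mul_le_mul_iff_left₀ hlog]

theorem mul_le_uncertaintyBound_sq {p κ : ℝ} (hp : 0 ≤ p) (hκ0 : 0 ≤ κ) (hκ1 : κ ≤ 1)
    (h : J * (p * Real.log (1 + 1 / lam ^ 2 * κ)) ≤ 2 * Γ) :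
    p * κ ≤ uncertaintyBound lam J Γ ^ 2 := by
  rw [← mul_le_mul_iff_right₀ (log_one_add_inv_sq_pos hlam)]
  calc Real.log (1 + 1 / lam ^ 2) * (p * κ) = p * (κ * Real.log (1 + 1 / lam ^ 2)) := by ring
    _ ≤ p * Real.log (1 + κ * (1 / lam ^ 2)) := by
        gcongr
        exact mul_log_one_add_le hκ0 hκ1 (by positivity)
    _ ≤ _ := le_log_mul_uncertaintyBound_sq hlam hJ (by rwa [mul_comm κ])

theorem le_uncertaintyBound (hu0 : 0 ≤ u) (hu1 : u ≤ 1)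
    (h : J * Real.log (1 + 1 / lam ^ 2 * u ^ 2) ≤ 2 * Γ) : u ≤ uncertaintyBound lam J Γ := by
  refine le_of_sq_le_sq ?_ uncertaintyBound_nonneg
  rw [← one_mul (u ^ 2)]
  exact mul_le_uncertaintyBound_sq hlam hJ zero_le_one (sq_nonneg u) (pow_le_one₀ hu0 hu1)
    (by rwa [one_mul])

theorem div_sqrt_le_uncertaintyBound (hu0 : 0 ≤ u) (hu1 : u ≤ 1)
    (h : Real.log (1 + 1 / lam ^ 2 * u ^ 2) ≤ 2 * Γ) : u / √J ≤ uncertaintyBound lam J Γ := by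
  have hJ' : (J : ℝ) ≠ 0 := Nat.cast_ne_zero.2 (by omega)
  refine le_of_sq_le_sq ?_ uncertaintyBound_nonneg
  rw [div_pow, Real.sq_sqrt (Nat.cast_nonneg J), div_eq_inv_mul]
  exact mul_le_uncertaintyBound_sq hlam hJ (by positivity) (sq_nonneg u) (pow_le_one₀ hu0 hu1)
    (by rwa [mul_inv_cancel_left₀ hJ'])

end UncertaintyBound

section Net

theorem netResolution_pos (hlam : 0 < lam) : 0 < netResolution lam u :=
  Real.sqrt_pos.2 (by positivity)

theorem netResolution_le_one (hu0 : 0 ≤ u) (hu1 : u ≤ 1) : netResolution lam u ≤ 1 := by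
  refine Real.sqrt_le_one.2 (div_le_one_of_le₀ ?_ (by positivity))
  gcongr
  exact pow_le_one₀ hu0 hu1

theorem netResolution_le_add (hlam : 0 < lam) (hu : 0 ≤ u) : netResolution lam u ≤ u + lam := by
  refine Real.sqrt_le_iff.2 ⟨by positivity, ?_⟩
  calc (u ^ 2 + lam ^ 2) / (1 + lam ^ 2) ≤ u ^ 2 + lam ^ 2 :=
        div_le_self (by positivity) (by linarith [sq_nonneg lam])
    _ ≤ (u + lam) ^ 2 := by nlinarith [mul_nonneg hu hlam.le]

theorem log_inv_netResolution (hlam : 0 < lam) :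
    Real.log (netResolution lam u)⁻¹ =
      1 / 2 * Real.log ((1 + 1 / lam ^ 2) / (1 + u ^ 2 * (1 / lam ^ 2))) := by
  have hratio : (1 + 1 / lam ^ 2) / (1 + u ^ 2 * (1 / lam ^ 2)) =
      ((u ^ 2 + lam ^ 2) / (1 + lam ^ 2))⁻¹ := by
    field_simp
    ring
  rw [hratio, Real.log_inv, Real.log_inv, netResolution, Real.log_sqrt (by positivity)]
  ring

/-- The finer net needed for a small uncertainty `u` is paid for by the factor `u ^ 2`. -/
theorem sq_mul_log_inv_netResolution_le (hlam : 0 < lam) (hJ : 1 ≤ J) (hu0 : 0 ≤ u) (hu1 : u ≤ 1)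
    (h : J * Real.log (1 + 1 / lam ^ 2 * u ^ 2) ≤ 2 * Γ) :
    u ^ 2 * Real.log (netResolution lam u)⁻¹ ≤ 5 / 2 * uncertaintyBound lam J Γ ^ 2 := by
  rw [mul_comm (1 / lam ^ 2)] at h
  have hlog := mul_log_div_mul_log_le (y := 1 / lam ^ 2) (sq_nonneg u) (pow_le_one₀ hu0 hu1)
    (by positivity)
  rw [← mul_le_mul_iff_left₀ (log_one_add_inv_sq_pos hlam), log_inv_netResolution hlam]
  linarith [le_log_mul_uncertaintyBound_sq hlam hJ h]

theorem half_le_mul_log (hd : 1 ≤ d) {X : ℝ} (hX : 2 ≤ X) : 1 / 2 ≤ d * Real.log X := by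
  have hd' : (1 : ℝ) ≤ d := by exact_mod_cast hd
  nlinarith [Real.log_two_gt_d9, Real.log_le_log two_pos hX]

/-- A net of resolution `r / N` has of the order of `cD (N / r) ^ d` points. -/
theorem two_mul_card_net_le (hcD : 0 < cD) (hd : 1 ≤ d) {N ε r : ℝ} (hN : 2 ≤ N) (hε0 : 0 < ε)
    (hε1 : ε ≤ 1) (hr : 0 < r) {n : ℕ} (hn : n ≤ 2 * (N / r)) :
    2 * (cD * n ^ d) ≤
      ε * Real.exp (netConst cD * (d * Real.log (N / ε)) + d * Real.log r⁻¹) := by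
  have hX : 2 ≤ N / ε := by
    rw [le_div_iff₀ hε0]
    nlinarith
  have hexp (t : ℝ) (ht : 0 < t) : t ^ d = Real.exp (d * Real.log t) := by
    rw [Real.exp_nat_mul, Real.exp_log ht]
  have hconst : 1 + 2 * cD ≤ Real.exp (2 * Real.log (1 + 2 * cD) * (d * Real.log (N / ε))) := by
    rw [← Real.log_le_iff_le_exp (by positivity)]
    nlinarith [half_le_mul_log hd hX, Real.log_nonneg (by linarith : 1 ≤ 1 + 2 * cD)]
  calc 2 * (cD * n ^ d) ≤ (1 + 2 * cD) * (2 * (N / r)) ^ d := by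
        rw [← mul_assoc]
        gcongr
        linarith
    _ = (1 + 2 * cD) * (2 ^ d * (ε ^ d * (N / ε) ^ d * r⁻¹ ^ d)) := by
        rw [← mul_pow, ← mul_pow, ← mul_pow]
        field_simp
    _ ≤ (1 + 2 * cD) * ((N / ε) ^ d * (ε * (N / ε) ^ d * r⁻¹ ^ d)) := by
        gcongr
        exact pow_le_of_le_one hε0.le hε1 (by omega)
    _ ≤ Real.exp (2 * Real.log (1 + 2 * cD) * (d * Real.log (N / ε))) *
          ((N / ε) ^ d * (ε * (N / ε) ^ d * r⁻¹ ^ d)) := by gcongr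
    _ = _ := by
        rw [hexp _ (by positivity), hexp _ (by positivity), netConst, add_mul, two_mul (_ * _),
          Real.exp_add, Real.exp_add, Real.exp_add]
        ring

end Net

section Width

variable (hlam : 0 < lam) {g ℓ : ℝ} (hg : 0 < g)
include hlam hg

theorem noise_width_le (hcD : 0 < cD) (hu : 0 ≤ u) (hℓ : 1 / 2 ≤ ℓ) {σ : ℝ} (huσ : u ≤ σ) {ρ : ℝ}
    (huρ : u ^ 2 * ρ ≤ 5 / 2 * σ ^ 2) :
    u / lam * (1 / g) * √((netConst cD * (d * ℓ) + d * ρ) / 2) ≤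
      σ / (lam * g) * (√((netConst cD + 5) / 2) * √(d * ℓ)) := by
  have hconst := two_le_netConst hcD
  have hσ : 0 ≤ σ := hu.trans huσ
  have hmain : u * √((netConst cD * (d * ℓ) + d * ρ) / 2) ≤
      σ * (√((netConst cD + 5) / 2) * √(d * ℓ)) := by
    rw [← Real.sqrt_mul (by linarith), ← Real.sqrt_sq hu, ← Real.sqrt_sq hσ,
      ← Real.sqrt_mul (sq_nonneg _), ← Real.sqrt_mul (sq_nonneg _)]
    refine Real.sqrt_le_sqrt ?_
    have hfirst : u ^ 2 * (netConst cD * (d * ℓ)) ≤ σ ^ 2 * (netConst cD * (d * ℓ)) := by gcongr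
    have hsecond : d * (u ^ 2 * ρ) ≤ d * (5 * ℓ * σ ^ 2) :=
      mul_le_mul_of_nonneg_left (huρ.trans (by nlinarith [sq_nonneg σ])) (Nat.cast_nonneg d)
    linarith
  calc _ = 1 / (lam * g) * (u * √((netConst cD * (d * ℓ) + d * ρ) / 2)) := by field_simp
    _ ≤ 1 / (lam * g) * (σ * (√((netConst cD + 5) / 2) * √(d * ℓ))) := by gcongr
    _ = _ := by ring

theorem rounding_width_le (hJ : 1 ≤ J) (hu : 0 ≤ u) {n : ℝ} (hn : J / netResolution lam u ≤ n) :
    √J / (lam * g) * (1 / n) ≤ u / (lam * g) + 1 / √J / g := by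
  have hJ' : (1 : ℝ) ≤ √J := Real.one_le_sqrt.2 (by exact_mod_cast hJ)
  have hr := netResolution_pos (u := u) hlam
  have hinv : 1 / n ≤ (u + lam) / (√J * √J) :=
    calc 1 / n ≤ 1 / (J / netResolution lam u) := one_div_le_one_div_of_le (by positivity) hn
      _ = netResolution lam u / (√J * √J) := by
          rw [one_div_div, Real.mul_self_sqrt (Nat.cast_nonneg J)]
      _ ≤ _ := by
          gcongr
          exact netResolution_le_add hlam hu
  calc √J / (lam * g) * (1 / n) ≤ √J / (lam * g) * ((u + lam) / (√J * √J)) := by gcongr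
    _ = u / (lam * g) * (1 / √J) + 1 / √J / g := by field_simp
    _ ≤ u / (lam * g) + 1 / √J / g := by
        gcongr
        exact mul_le_of_le_one_right (by positivity) (div_le_one_of_le₀ hJ' (by positivity))

theorem total_width_le {c b : ℝ} (hc : 0 ≤ c) (hℓ : 1 / 2 ≤ d * ℓ) (hu : 0 ≤ u) {σ : ℝ}
    (huσ : u ≤ σ) (hb : b ≤ c * σ) :
    c * (1 / g) * u + (u / (lam * g) + b / g) +
        2 * (σ / (lam * g) * (√((netConst cD + 5) / 2) * √(d * ℓ))) ≤
      widthConst cD * (c / g + 1 / (2 * lam * g) * √(d * ℓ)) * σ := by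
  have hσ : 0 ≤ σ := hu.trans huσ
  have hsqrt : 1 ≤ 2 * √(d * ℓ) := by
    linarith [Real.le_sqrt_of_sq_le (by linarith : (1 / 2 : ℝ) ^ 2 ≤ d * ℓ)]
  set R := √((netConst cD + 5) / 2) with hR
  have hR0 : 0 ≤ R := Real.sqrt_nonneg _
  calc _ ≤ c * (1 / g) * σ + (σ / (lam * g) * (2 * √(d * ℓ)) + c * σ / g) +
        2 * (σ / (lam * g) * (R * √(d * ℓ))) := by
        gcongr
        calc u / (lam * g) ≤ σ / (lam * g) := by gcongr
          _ ≤ _ := le_mul_of_one_le_right (by positivity) hsqrt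
    _ = 2 * (c / g) * σ + (4 + 4 * R) * (1 / (2 * lam * g) * √(d * ℓ)) * σ := by
        field_simp
        ring
    _ ≤ (4 + 4 * R) * (c / g) * σ + (4 + 4 * R) * (1 / (2 * lam * g) * √(d * ℓ)) * σ := by
        gcongr
        linarith
    _ = _ := by
        rw [widthConst, ← hR]
        ring

end Width

end ErrorSize

/-! ### The error width of a maximum uncertainty design -/

section Width

variable {S A : Type*} [MeasurableSpace S] [MeasurableSpace A] {M : MDP S A}
  {K : S × A → S × A → ℝ} {lam u δ Γ : ℝ} {J L : ℕ} {z : Fin J → S × A}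

variable {H : Type*} [NormedAddCommGroup H] [InnerProductSpace ℝ H] [CompleteSpace H]
  [RKHS ℝ H (S × A) ℝ] {ν : Measure S} [IsFiniteMeasure ν]

/-- Without randomness there is only the bias of the regression. -/
theorem IsFeatureMap.hasErrorWidth_of_subsingleton [Subsingleton S]
    (hφ : IsFeatureMap (feature H) K) (hlam : 0 < lam) (hdens : HasBoundedDensity H ν M.P)
    (hu : 0 ≤ u) (hux : ∀ x, uncertaintySq K lam z x ≤ u ^ 2) (hδ : 0 ≤ δ) :
    HasErrorWidth M K lam L z δ (ν.real Set.univ * (1 / (1 - M.γ)) * u) := by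
  have hγ := M.one_sub_γ_pos
  refine HasErrorWidth.of_forall hδ (by positivity) fun ω l x => ?_
  have hnoise : roundNoise M K lam z ω l = 0 := by
    funext j
    have hconst (s : S) : roundValue M K lam z ω l s = roundValue M K lam z ω l (ω l j) :=
      congrArg _ (Subsingleton.elim _ _)
    simp [roundNoise, MDP.nextExp, hconst]
  simpa [hnoise, krr] using hφ.abs_bellmanError_le hlam hdens
    (Subsingleton.measurable (f := roundValue M K lam z ω l)) hu (hux x)

/-- For a single point, `log (J / ((1 - γ) δ))` may be arbitrarily close to zero, so the noise is
bounded deterministically. -/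
theorem IsFeatureMap.hasErrorWidth_of_single {z : Fin 1 → S × A}
    (hφ : IsFeatureMap (feature H) K) (hlam : 0 < lam) (hdens : HasBoundedDensity H ν M.P)
    (hmeas : ∀ (ω : Fin L → Fin 1 → S) l, Measurable (roundValue M K lam z ω l)) (hu : 0 ≤ u)
    (hux : ∀ x, uncertaintySq K lam z x ≤ u ^ 2) (hxu : ∀ x, ‖feature H x‖ ≤ u) (hδ : 0 ≤ δ) :
    HasErrorWidth M K lam L z δ (3 * (ν.real Set.univ * (1 / (1 - M.γ)) * u)) := by
  have hγ := M.one_sub_γ_pos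
  refine HasErrorWidth.of_forall hδ (by positivity) fun ω l x => ?_
  have hweight : |ridgeWeights K lam z x 0| ≤ 2 * (ν.real Set.univ * u) :=
    calc |ridgeWeights K lam z x 0|
        ≤ |ridgeWeights K lam z x 0| * (ν.real Set.univ * ‖feature H (z 0)‖) :=
          le_mul_of_one_le_right (abs_nonneg _) (hdens.one_le_mul_norm _)
      _ = ν.real Set.univ * ‖∑ j, ridgeWeights K lam z x j • feature H (z j)‖ := by
          rw [Fin.sum_univ_one, norm_smul, Real.norm_eq_abs, mul_left_comm]
      _ ≤ ν.real Set.univ * (2 * u) := by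
          gcongr
          linarith [hφ.norm_sum_ridgeWeights_smul_le hlam z x, hxu x]
      _ = _ := by ring
  have hnoise : |krr K lam z (roundNoise M K lam z ω l) x| ≤
      2 * (ν.real Set.univ * u) * (1 / (1 - M.γ)) := by
    rw [hφ.krr_eq_dotProduct_ridgeWeights, dotProduct, Fin.sum_univ_one, abs_mul]
    gcongr
    exact abs_roundNoise_le M K lam z ω l 0
  refine (hφ.abs_bellmanError_le hlam hdens (hmeas ω l) hu (hux x)).trans
    (mul_le_mul_of_nonneg_left ?_ M.γ_pos.le)
  linarith

variable {cD : ℝ} {d : ℕ} [TopologicalSpace A] [TopologicalSpace.SeparableSpace A]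

theorem IsFeatureMap.hasErrorWidth_of_covering (hφ : IsFeatureMap (feature H) K)
    (hK : IsActionContinuousKernel K) (hr : ∀ s, Continuous fun a => M.r (s, a)) (hlam : 0 < lam)
    (hdens : HasBoundedDensity H ν M.P) (hcD : 0 < cD)
    (hcov : HasPolynomialCovering (feature (Z := S × A) H) cD d) (hd : 1 ≤ d) (hJ : 2 ≤ J)
    (hu0 : 0 ≤ u) (hu1 : u ≤ 1) (hux : ∀ x, uncertaintySq K lam z x ≤ u ^ 2)
    (hΓ : J * Real.log (1 + 1 / lam ^ 2 * u ^ 2) ≤ 2 * Γ)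
    (hJΓ : 1 / √J ≤ ν.real Set.univ * uncertaintyBound lam J Γ) (hδ0 : 0 < δ) (hδ1 : δ ≤ 1) :
    HasErrorWidth M K lam L z δ
      (widthConst cD * widthOrder (ν.real Set.univ) M.γ lam d J δ * uncertaintyBound lam J Γ) := by
  have hγ := M.one_sub_γ_pos
  have hε : (1 - M.γ) * δ ≤ 1 := mul_le_one₀ (by linarith [M.γ_pos]) hδ0.le hδ1
  have hJ1 : 1 ≤ J := by omega
  have hJ' : (2 : ℝ) ≤ J := by exact_mod_cast hJ
  have hX : 2 ≤ J / ((1 - M.γ) * δ) :=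
    hJ'.trans (le_div_self (by positivity) (by positivity) hε)
  have hℓ (k : ℕ) (hk : 1 ≤ k) := half_le_mul_log hk hX
  set r := netResolution lam u
  set ℓ := Real.log (J / ((1 - M.γ) * δ))
  have hr0 : 0 < r := netResolution_pos hlam
  have hr1 : r ≤ 1 := netResolution_le_one hu0 hu1
  have huσ := le_uncertaintyBound hlam hJ1 hu0 hu1 hΓ
  have hn : 1 ≤ J / r := by rw [le_div_iff₀ hr0]; linarith
  obtain ⟨D, hcard, hnet⟩ := hcov ⌈J / r⌉₊ (Nat.one_le_ceil_iff.2 (by linarith))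
  have ha : 1 ≤ netConst cD * (d * ℓ) + d * Real.log r⁻¹ := by
    have hlog := Real.log_nonneg ((one_le_inv₀ hr0).2 hr1)
    have : 0 ≤ d * Real.log r⁻¹ := by positivity
    nlinarith [two_le_netConst hcD, hℓ d hd]
  have hD : 2 * D.card ≤ (1 - M.γ) * δ *
      Real.exp (netConst cD * (d * ℓ) + d * Real.log r⁻¹) := by
    refine le_trans (by gcongr) (two_mul_card_net_le hcD hd hJ' (by positivity) hε hr0
      (n := ⌈J / r⌉₊) ?_)
    linarith [Nat.ceil_lt_add_one (by positivity : 0 ≤ J / r)]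
  refine (hφ.hasErrorWidth_of_net hK hr hlam hdens (by positivity) hnet hu0 hux hδ0.le ha
    hD).mono ?_
  calc _ ≤ ν.real Set.univ * (1 / (1 - M.γ)) * u + (u / (lam * (1 - M.γ)) + 1 / √J / (1 - M.γ)) +
        2 * (uncertaintyBound lam J Γ / (lam * (1 - M.γ)) *
          (√((netConst cD + 5) / 2) * √(d * ℓ))) := by
        have hrounding := rounding_width_le hlam hγ hJ1 hu0 (Nat.le_ceil (J / r))
        have hnoise := noise_width_le (d := d) hlam hγ hcD hu0 (by simpa using hℓ 1 le_rfl) huσ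
          (sq_mul_log_inv_netResolution_le hlam hJ1 hu0 hu1 hΓ)
        linarith
    _ ≤ _ := total_width_le hlam hγ measureReal_nonneg (hℓ d hd) hu0 huσ hJΓ

theorem le_widthConst_mul_widthOrder_mul {c γ σ w : ℝ} (hlam : 0 < lam) (hγ : γ < 1)
    (hc : 0 ≤ c) (hσ : 0 ≤ σ) (hw : w ≤ 4 * (c * (1 / (1 - γ)) * σ)) :
    w ≤ widthConst cD * widthOrder c γ lam d J δ * σ := by
  have : 0 < 1 - γ := sub_pos.2 hγ
  have hconst := four_le_widthConst cD
  calc w ≤ 4 * (c / (1 - γ)) * σ := hw.trans_eq (by ring)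
    _ ≤ _ := by
        gcongr
        exact le_add_of_nonneg_right (by positivity)

theorem IsMaxUncertaintyDesign.hasErrorWidth (hz : IsMaxUncertaintyDesign K lam z)
    (hφ : IsFeatureMap (feature H) K) (hK1 : ∀ x, K x x ≤ 1) (hK : IsActionContinuousKernel K)
    (hr : ∀ s, Continuous fun a => M.r (s, a)) (hdens : HasBoundedDensity H ν M.P) (hcD : 0 < cD)
    (hcov : HasPolynomialCovering (feature (Z := S × A) H) cD d) (hd : 1 ≤ d ∨ Subsingleton S)
    (hlam : 0 < lam) (hJ : 1 ≤ J) (hδ0 : 0 < δ) (hδ1 : δ ≤ 1) :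
    HasErrorWidth M K lam L z δ (widthConst cD * widthOrder (ν.real Set.univ) M.γ lam d J δ *
      uncertaintyBound lam J (infoGain K lam J)) := by
  set σ := uncertaintyBound lam J (infoGain K lam J)
  have hγ := M.one_sub_γ_pos
  have hσ : 0 ≤ σ := uncertaintyBound_nonneg
  obtain ⟨u, hu0, hu1, hux, hΓ⟩ := hz.exists_uncertaintySq_le_sq hφ hK1 hlam hJ
  have huσ := le_uncertaintyBound hlam hJ hu0 hu1 hΓ
  have hxσ (x : S × A) : ‖feature H x‖ / √J ≤ σ :=
    div_sqrt_le_uncertaintyBound hlam hJ (norm_nonneg _)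
      ((sq_le_one_iff₀ (norm_nonneg _)).1 ((hφ.norm_sq x).trans_le (hK1 x)))
      (by simpa only [hφ.norm_sq] using hφ.log_diag_le_infoGain hK1 hlam hJ x)
  have hbias : 0 ≤ ν.real Set.univ * (1 / (1 - M.γ)) * σ := by positivity
  obtain _ | _ := hd.symm
  · refine (hφ.hasErrorWidth_of_subsingleton hlam hdens hu0 hux hδ0.le).mono
      (le_widthConst_mul_widthOrder_mul hlam M.γ_lt_one measureReal_nonneg hσ ?_)
    have : ν.real Set.univ * (1 / (1 - M.γ)) * u ≤ ν.real Set.univ * (1 / (1 - M.γ)) * σ := by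
      gcongr
    linarith
  obtain rfl | hJ2 := hJ.eq_or_lt
  · refine (hφ.hasErrorWidth_of_single hlam hdens (hK.measurable_roundValue lam z hr) hσ
      (fun x => (hux x).trans (by gcongr)) (fun x => by simpa using hxσ x) hδ0.le).mono
      (le_widthConst_mul_widthOrder_mul hlam M.γ_lt_one measureReal_nonneg hσ ?_)
    linarith
  · refine hφ.hasErrorWidth_of_covering hK hr hlam hdens hcD hcov ‹_› hJ2 hu0 hu1 hux hΓ ?_ hδ0 hδ1
    calc 1 / √J ≤ ν.real Set.univ * ‖feature H (z ⟨0, hJ⟩)‖ / √J := by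
          gcongr
          exact hdens.one_le_mul_norm _
      _ ≤ ν.real Set.univ * σ := by
          rw [mul_div_assoc]
          gcongr
          exact hxσ _

end Width

theorem pow_div_one_sub_le {γ : ℝ} (hγ0 : 0 < γ) (hγ1 : γ < 1) (L : ℕ) :
    γ ^ L / (1 - γ) ≤ 2 * γ ^ (L - 1) * (1 / (1 - γ)) ^ 2 := by
  have hγ : 0 < 1 - γ := sub_pos.2 hγ1
  have hinv : 1 ≤ 1 / (1 - γ) := (one_le_div hγ).2 (by linarith)
  calc γ ^ L / (1 - γ) ≤ γ ^ (L - 1) / (1 - γ) :=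
        div_le_div_of_nonneg_right (pow_le_pow_of_le_one hγ0.le hγ1.le (Nat.sub_le L 1)) hγ.le
    _ = 1 * γ ^ (L - 1) * (1 / (1 - γ)) := by ring
    _ ≤ 2 * γ ^ (L - 1) * (1 / (1 - γ)) ^ 2 := by
        gcongr
        · exact one_le_two
        · exact le_self_pow₀ hinv two_ne_zero

end KQ

theorem theorem1_general {S A : Type*} [MeasurableSpace S] [MeasurableSpace A]
    [TopologicalSpace A] [CompactSpace A] [TopologicalSpace.SeparableSpace A] [Nonempty A]
    (M : KQ.MDP S A) (hr : ∀ s, Continuous fun a => M.r (s, a)) (K : S × A → S × A → ℝ)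
    (hKm : ∀ y, Measurable fun x => K x y)
    (hKc : ∀ s, Continuous (Function.uncurry fun a b => K (s, a) (s, b))) (hK1 : ∀ z, K z z ≤ 1)
    (H : Type*) [NormedAddCommGroup H] [InnerProductSpace ℝ H] [CompleteSpace H]
    [RKHS ℝ H (S × A) ℝ] (hH : KQ.IsRKHSOf H K) {cD : ℝ} (hcD : 0 < cD) {d : ℕ}
    (hcov : KQ.HasPolynomialCovering (KQ.feature (Z := S × A) H) cD d)
    (hd : 1 ≤ d ∨ Subsingleton S) (ν : Measure S) [IsFiniteMeasure ν]
    (hdens : KQ.HasBoundedDensity H ν M.P) (lam : ℝ) (J L : ℕ) (δ : ℝ) (hlam : 0 < lam)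
    (hJ : 1 ≤ J) (hδ0 : 0 < δ) (hδ1 : δ < 1) (z : Fin J → S × A)
    (hz : KQ.IsMaxUncertaintyDesign K lam z) :
    ∃ E : Set (Fin L → Fin J → S), MeasurableSet E ∧
      ENNReal.ofReal (1 - δ) ≤ KQ.sampleLaw M L z E ∧
      ∀ ω ∈ E, ∀ π : KQ.Policy S A, KQ.IsGreedy π (KQ.outputQ M K lam z ω) →
        ∀ s, |M.value π s - M.optValue s| ≤
          2 * (KQ.widthConst cD * KQ.widthOrder (ν.real Set.univ) M.γ lam d J δ) *
              (M.γ / (1 - M.γ) ^ 2) *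
              √(2 * KQ.infoGain K lam J / (Real.log (1 + 1 / lam ^ 2) * J)) +
            M.γ ^ L / (1 - M.γ) := by
  have hφ : KQ.IsFeatureMap (KQ.feature H) K := hH.isFeatureMap
  have hφc (s : S) : Continuous fun a => KQ.feature H (s, a) :=
    KQ.IsFeatureMap.continuous (fun a b => hφ (s, a) (s, b)) (hKc s)
  have hKreg : KQ.IsActionContinuousKernel K := hφ.isActionContinuousKernel hKm hφc
  obtain ⟨E, hE, hprob, hgreedy⟩ := (hz.hasErrorWidth (L := L) hφ hK1 hKreg hr hdens hcD hcov hd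
    hlam hJ hδ0 hδ1.le).exists_forall_abs_value_sub_optValue_le
      (hdens.isActionContinuous hr hφc) hKreg
  refine ⟨E, hE, hprob, fun ω hω π hπ s => (hgreedy ω hω π hπ s).trans_eq ?_⟩
  rw [KQ.uncertaintyBound]
  ring

theorem theorem1 (cD : ℝ) (hcD : 0 < cD) :
    ∃ C : ℝ, 0 < C ∧
      ∀ (m k : ℕ) (S : Set (EuclideanSpace ℝ (Fin m))) (A : Set (EuclideanSpace ℝ (Fin k))),
        IsCompact S → IsCompact A → S.Nonempty → A.Nonempty →
      ∀ (M : KQ.MDP S A), (∀ s, Continuous fun a => M.r (s, a)) →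
      ∀ (K : S × A → S × A → ℝ) (H : Type*) [NormedAddCommGroup H] [InnerProductSpace ℝ H]
        [CompleteSpace H] [RKHS ℝ H (S × A) ℝ],
        KQ.IsRKHSOf H K → Continuous (Function.uncurry K) → (∀ z, K z z ≤ 1) →
        KQ.HasDiscretization H cD →
      ∀ (ν : Measure S) [IsFiniteMeasure ν], KQ.HasBoundedDensity H ν M.P →
      ∀ (lam : ℝ) (J L : ℕ) (δ : ℝ), 0 < lam → 1 ≤ J → 1 ≤ L → 0 < δ → δ < 1 →
      ∀ z : Fin J → S × A, KQ.IsMaxUncertaintyDesign K lam z →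
      ∃ E : Set (Fin L → Fin J → S), MeasurableSet E ∧
        ENNReal.ofReal (1 - δ) ≤ KQ.sampleLaw M L z E ∧
        ∀ ω ∈ E, ∀ π : KQ.Policy S A, KQ.IsGreedy π (KQ.outputQ M K lam z ω) →
          ∀ s, |M.value π s - M.optValue s| ≤
            2 * (C * KQ.widthOrder (ν.real Set.univ) M.γ lam (m + k) J δ) *
                (M.γ / (1 - M.γ) ^ 2) *
                √(2 * KQ.infoGain K lam J / (Real.log (1 + 1 / lam ^ 2) * J)) +
              2 * M.γ ^ (L - 1) * (1 / (1 - M.γ)) ^ 2 := by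
  refine ⟨KQ.widthConst cD, by linarith [KQ.four_le_widthConst cD], ?_⟩
  intro m k S A _ hA _ hAne M hr K H _ _ _ _ hH hK hK1 hdisc ν _ hdens lam J L δ hlam hJ _
    hδ0 hδ1 z hz
  have : CompactSpace A := isCompact_iff_compactSpace.1 hA
  have : Nonempty A := hAne.to_subtype
  have hKm (y : S × A) : Measurable fun x => K x y :=
    (hK.comp (continuous_id.prodMk continuous_const)).measurable
  have hKc (s : S) : Continuous (Function.uncurry fun a b => K (s, a) (s, b)) :=
    hK.comp ((continuous_const.prodMk continuous_fst).prodMk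
      (continuous_const.prodMk continuous_snd))
  have hd : 1 ≤ m + k ∨ Subsingleton S := by
    obtain rfl | hm := m.eq_zero_or_pos
    · exact Or.inr inferInstance
    · exact Or.inl (by omega)
  obtain ⟨E, hE, hprob, hgreedy⟩ := theorem1_general M hr K hKm hKc hK1 H hH hcD
    hdisc.hasPolynomialCovering hd ν hdens lam J L δ hlam hJ hδ0 hδ1 z hz
  exact ⟨E, hE, hprob, fun ω hω π hπ s => (hgreedy ω hω π hπ s).trans
    (add_le_add_right (KQ.pow_div_one_sub_le M.γ_pos M.γ_lt_one L) _)⟩
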